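/- Let $\mathbb T$ be the unit circle, $\ell$ its normalized Lebesgue measure, and let all $L^p$ norms and integrals over subsets of $\mathbb T$ below be taken with respect to $\ell$. Let $I\subset\mathbb T$ and $J=\mathbb T\setminus I$ satisfy $\ell(I)>0$, $\ell(J)>0$ and $\ell(\partial I)=0$. Let $H^2$ be the space of functions in $L^2(\mathbb T)$ whose Fourier coefficients of strictly negative index vanish. Write $h_1\vee h_2$ for the function equal to $h_1$ on $I$ and to $h_2$ on $J$. For a non-negative function $M\in L^2(J)$ with $\log M\in L^1(J)$, let $L^1_+(M^2,J)$ be the set of non-negative functions $\mu$ on $J$ such that $\mu M^2\in L^1(J)$ and $\log\mu\in L^1(J)$, and for such $\mu$ and $f\in L^2(I)$ put $$\Phi_M(\mu)=\inf_{g\in H^2}\Big(\|f-g\|_{L^2(I)}^2+\int_J\mu\,(|g|^2-M^2)\,d\ell\Big),$$ where the expression is $+\infty$ if $\mu|g|^2\notin L^1(J)$. Let $$w_{\mu^{1/2}}(z)=\exp\Big(\int_{\mathbb T}\frac{\xi+z}{\xi-z}\,\log\big(1\vee\mu^{1/2}\big)(\xi)\,d\ell(\xi)\Big),\qquad |z|<1,$$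 be the outer function with modulus $1$ on $I$ and $\mu^{1/2}$ on $J$, and put $$g_\mu(z)=\frac1{2i\pi\,w_{\mu^{1/2}}(z)}\int_I\frac{w_{\mu^{1/2}}(\xi)f(\xi)}{\xi-z}\,d\xi,\qquad |z|<1 .$$ Boundary values of functions on the disk are nontangential limits. Let $f\in L^2(I)$ be such that $|f|^2\vee 0$ lies in the Zygmund class $L\log^+L$, i.e. $|f|^2\log^+|f|^2\in L^1(I)$, and let $\mu$ be a function on $J$. There is a function $\mathbf o:\mathbb R\to\mathbb R$, depending on $I$, $f$ and $\mu$ only, with $\mathbf o(t)/t\to0$ as $t\to0$ and $\mathbf o(0)=0$, such that the following holds for every non-negative $M\in L^2(J)$ with $\log M\in L^1(J)$ for which $\mu\in L^1_+(M^2,J)$ and for which $f$ is not the trace on $I$ of an $H^2$-function of modulus at most $M$ a.e. on $J$, and for every real measurable function $h$ on $J$ with $\|h/\mu\|_{L^\infty(J)}<1$: one has $\mu+h\in L^1_+(M^2,J)$ and $hM^2\in L^1(J)$; the function $g_\mu$ has a nontangential limit a.e. on $J$ and $h|g_\mu|^2\in L^1(J)$; and $$\Big|\Phi_M(\mu+h)-\Phi_M(\mu)-\int_J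 h\,(|g_\mu|^2-M^2)\,d\ell\Big|\le\mathbf o\big(\|h/\mu\|_{L^\infty(J)}\big).$$ -/

import Mathlib

open MeasureTheory Filter Topology Asymptotics
open scoped Real ENNReal

noncomputable section

namespace BoundedExtremal

instance instFactTwoPiPos : Fact (0 < 2 * π) := ⟨Real.two_pi_pos⟩

/-- The unit circle, parametrized by the angle `θ` modulo `2π`. -/
abbrev T : Type := AddCircle (2 * π)

/-- The point `e^{iθ}` of the complex plane. -/
def expI (θ : T) : ℂ := (AddCircle.toCircle θ : ℂ)

/-- Normalized Lebesgue measure on the circle, of total mass one. -/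
abbrev ell : Measure T := AddCircle.haarAddCircle

/-- The Hardy space `H²`: square integrable functions on the circle whose Fourier coefficients of
strictly negative index vanish. -/
def MemH2 (g : T → ℂ) : Prop :=
  MemLp g 2 ell ∧ ∀ n : ℤ, n < 0 → fourierCoeff g n = 0

open Classical in
/-- Concatenation `h₁ ∨ h₂`: equal to `h₁` on `I` and to `h₂` on the complement of `I`. -/
def concat {E : Type*} (I : Set T) (h₁ h₂ : T → E) : T → E :=
  fun θ => if θ ∈ I then h₁ θ else h₂ θ

/-- `log u ∈ L¹(S)` for a real function `u ≥ 0`. As `log 0 = -∞`, this includes `u > 0` almost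
everywhere on `S`. -/
def LogIntegrableOn (u : T → ℝ) (S : Set T) : Prop :=
  (∀ᵐ θ ∂(ell.restrict S), 0 < u θ) ∧ IntegrableOn (fun θ => Real.log (u θ)) S ell

/-- `h ∈ L¹(M²dθ, J)`. -/
def MemL1Weighted (M : T → ℝ) (J : Set T) (h : T → ℝ) : Prop :=
  IntegrableOn (fun θ => h θ * M θ ^ 2) J ell

/-- `u ∈ L¹₊(M²dθ, J)`: the function `u` is non-negative on `J`, it lies in `L¹(M²dθ, J)`, and its
logarithm lies in `L¹(J)`. -/
def MemL1Plus (M : T → ℝ) (J : Set T) (u : T → ℝ) : Prop :=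
  (∀ᵐ θ ∂(ell.restrict J), 0 ≤ u θ) ∧ MemL1Weighted M J u ∧ LogIntegrableOn u J

/-- The Zygmund class `L log⁺ L` on the circle. -/
def MemLLogL (φ : T → ℝ) : Prop :=
  AEStronglyMeasurable φ ell ∧ Integrable (fun θ => φ θ * Real.posLog |φ θ|) ell

/-- The restriction of `f` to `I` is the trace on `I` of an `H²`-function whose modulus is at most
`M` almost everywhere on the complement of `I`. -/
def IsAdmissibleTrace (I : Set T) (f : T → ℂ) (M : T → ℝ) : Prop :=
  ∃ g : T → ℂ, MemH2 g ∧ (∀ᵐ θ ∂(ell.restrict Iᶜ), ‖g θ‖ ≤ M θ) ∧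
    ∀ᵐ θ ∂(ell.restrict I), f θ = g θ

/-- The criterion `‖f - g‖²_{L²(I)} + ∫_J u (|g|² - M²)`, with `J` the complement of `I`. -/
def lagrangian (I : Set T) (f : T → ℂ) (M u : T → ℝ) (g : T → ℂ) : ℝ :=
  (∫ θ in I, ‖f θ - g θ‖ ^ 2 ∂ell) + ∫ θ in Iᶜ, u θ * (‖g θ‖ ^ 2 - M θ ^ 2) ∂ell

/-- The dual functional `Φ_M(u)`, the infimum of the criterion over `g ∈ H²`. When `u |g|²` is not
integrable on `J` the criterion is `+∞` (as `u ≥ 0` and `u M²` is integrable), so that such `g` are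
left out; `g = 0` is always kept and `-∫_J u M²` is a lower bound. -/
def dualFunctional (I : Set T) (f : T → ℂ) (M u : T → ℝ) : ℝ :=
  sInf {v : ℝ | ∃ g : T → ℂ, MemH2 g ∧ IntegrableOn (fun θ => u θ * ‖g θ‖ ^ 2) Iᶜ ell ∧
    v = lagrangian I f M u g}

/-- The Stolz (nontangential approach) region of aperture `α` with vertex `e^{iθ}`. -/
def stolzRegion (α : ℝ) (θ : T) : Set ℂ :=
  {z : ℂ | ‖z‖ < 1 ∧ ‖z - expI θ‖ < α * (1 - ‖z‖)}

/-- The function `F` on the unit disk has nontangential limit `b` at `e^{iθ}`. -/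
def HasNontangentialLimit (F : ℂ → ℂ) (θ : T) (b : ℂ) : Prop :=
  ∀ α : ℝ, 1 < α → Tendsto F (𝓝[stolzRegion α θ] (expI θ)) (𝓝 b)

open Classical in
/-- The boundary function of `F`: its nontangential limits, where they exist. -/
def boundaryValue (F : ℂ → ℂ) (θ : T) : ℂ :=
  if h : ∃ b, HasNontangentialLimit F θ b then h.choose else 0

/-- The outer function on the disk with modulus `ρ` on the circle. -/
def outer (ρ : T → ℝ) (z : ℂ) : ℂ :=
  Complex.exp (∫ θ, (expI θ + z) / (expI θ - z) * (Real.log (ρ θ) : ℂ) ∂ell)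

/-- The outer function `w_{u^{1/2}}` with modulus `1` on `I` and `u^{1/2}` on its complement. -/
def outerSqrt (I : Set T) (u : T → ℝ) : ℂ → ℂ :=
  outer (concat I (fun _ => 1) (fun θ => Real.sqrt (u θ)))

/-- The function
`g_u(z) = (2πi w(z))⁻¹ ∫_I w(ξ) f(ξ) / (ξ - z) dξ`, with `w = w_{u^{1/2}}`, for `z` in the disk.
Here `ξ = e^{iθ}` and `dξ = i e^{iθ} dθ`, where the measure `volume` on the circle is `dθ`, of total
mass `2π`. -/
def carleman (I : Set T) (f : T → ℂ) (u : T → ℝ) (z : ℂ) : ℂ :=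
  (2 * π * Complex.I * outerSqrt I u z)⁻¹ *
    ∫ θ in I, boundaryValue (outerSqrt I u) θ * f θ / (expI θ - z) * (Complex.I * expI θ)

/-- The norm of `h` in `L^∞(S)`. -/
def normLinf (S : Set T) (h : T → ℝ) : ℝ := (eLpNorm h ∞ (ell.restrict S)).toReal

end BoundedExtremal

end

noncomputable section

namespace BoundedExtremal

open ComplexConjugate

/-! Write `w` for the outer function with `|w| = 1` on `I` and `|w|² = μ` on `J`, let `F` be `w f`
on `I` and `0` on `J`, and let `G` be the orthogonal projection of `F` onto `H²`. For admissible `g`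
the Lagrangian is `‖F - w g‖² - ∫_J μ M²`. The products `w g` lie in `H²` (`MemH2.outer_mul`) and
are dense there (`MemH2.exists_tendsto_outer_mul`), so `dualFunctional_eq` gives `Φ_M(μ) = ‖F - G‖²
- ∫_J μ M²`. Moreover `g_μ = G / w`, so that `h |g_μ|² = (h/μ) |G|²` on `J`. The term in `M` is
linear in the weight and contributes exactly its derivative; only the squared distance to `H²` has
to be expanded.

Let `R` be `h/μ` on `J` and `0` on `I`. Passing from `μ` to `μ + h` replaces `F` by `F' = D F`,
where `D` is outer, `|D|² = 1 + R`, and `D` and `1/D` are bounded (`exists_multiplier`). Let `G'` be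
the projection of `F'`. Then `D G` competes for `F'` and `G'/D` competes for `F`. Since `F` vanishes
where `R` does not, these two trials give `‖F' - G'‖² ≤ ‖F - G‖² + ∫ R |G|²` and `‖F - G‖² ≤ ‖F' -
G'‖² - ∫ R/(1+R) |G'|²`. The error of the expansion is thus at most `∫ R |G|² - ∫ R/(1+R) |G'|²`
(`abs_distSq_sub_le`). With `t = ‖h/μ‖_∞` this is `t` times a quantity that is small once `‖G - G'‖
≤ ‖F - F'‖` is.

Uniformity in `h` comes from the mean value of `D`: it gives `‖D - 1‖² ≤ 3t`, and splitting `F` at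
height `t^{-1/4}` bounds `‖(D - 1) F‖²` in terms of `t` and `F` alone. The remainder therefore
depends only on `I`, `f` and `μ`.

The earlier material supplies Fatou's theorem and the boundary behaviour of outer functions that
this argument needs. -/

/-! ### Chords of the circle and the Poisson kernel -/

lemma norm_expI (t : T) : ‖expI t‖ = 1 := Circle.norm_coe _

lemma continuous_expI : Continuous expI :=
  continuous_subtype_val.comp AddCircle.continuous_toCircle

lemma expI_ne_zero (t : T) : expI t ≠ 0 := Circle.coe_ne_zero _

lemma expI_sub_ne_zero {z : ℂ} (hz : ‖z‖ < 1) (t : T) : expI t - z ≠ 0 := by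
  intro h
  rw [sub_eq_zero] at h
  rw [← h, norm_expI] at hz
  exact lt_irrefl _ hz

lemma one_sub_norm_le (z : ℂ) (t : T) : 1 - ‖z‖ ≤ ‖expI t - z‖ := by
  simpa [norm_expI] using norm_sub_norm_le (expI t) z

/-- A chord of the circle is at least `2 / π` times the corresponding arc. -/
lemma dist_le_norm_expI_sub (s t : T) : 2 / π * dist s t ≤ ‖expI s - expI t‖ := by
  have h1 : ‖expI s - expI t‖ = ‖expI (s - t) - 1‖ := by
    have : expI s = expI (s - t) * expI t := by
      simp only [expI]
      rw [← Circle.coe_mul, ← AddCircle.toCircle_add, sub_add_cancel]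
    rw [this, ← sub_one_mul, norm_mul, norm_expI, mul_one]
  rw [h1, dist_eq_norm]
  obtain ⟨x, ⟨hx1, hx2⟩, hx⟩ :=
    (AddCircle.coe_image_Ioc_eq (2 * π) (-π)).symm ▸ Set.mem_univ (s - t)
  rw [← hx]
  have hx3 : |x| ≤ π := abs_le.2 ⟨hx1.le, by linarith⟩
  have h2 : ‖expI (x : T) - 1‖ = 2 * |Real.sin (x / 2)| := by
    have : expI (x : T) = Complex.exp (Complex.I * x) := by
      rw [expI, AddCircle.toCircle_apply_mk, Circle.coe_exp]
      have : 2 * π / (2 * π) = 1 := div_self Real.two_pi_pos.ne'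
      rw [this, one_mul, mul_comm]
    rw [this, Complex.norm_exp_I_mul_ofReal_sub_one]
    simp
  have h3 := Real.mul_abs_le_abs_sin (x := x / 2) (by rw [abs_div, abs_two]; linarith)
  have h4 : ‖((x : ℝ) : T)‖ ≤ |x| := by
    simpa using QuotientAddGroup.norm_mk_le_norm (S := AddSubgroup.zmultiples (2 * π)) (m := x)
  rw [abs_div, abs_two] at h3
  rw [h2]
  have : 2 / π * ‖((x : ℝ) : T)‖ ≤ 2 / π * |x| := by gcongr
  linarith

/-- The Poisson kernel of the disk. -/
def poissonKer (z : ℂ) (t : T) : ℝ := (1 - ‖z‖ ^ 2) / ‖expI t - z‖ ^ 2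

/-- The Poisson integral of `φ`. -/
def poissonInt (φ : T → ℂ) (z : ℂ) : ℂ := ∫ t, (poissonKer z t : ℂ) * φ t ∂ell

lemma poissonKer_nonneg {z : ℂ} (hz : ‖z‖ < 1) (t : T) : 0 ≤ poissonKer z t := by
  have : ‖z‖ ^ 2 ≤ 1 := pow_le_one₀ (norm_nonneg _) hz.le
  unfold poissonKer
  positivity [sub_nonneg.2 this]

lemma continuous_poissonKer {z : ℂ} (hz : ‖z‖ < 1) : Continuous (poissonKer z) := by
  unfold poissonKer
  refine continuous_const.div ((continuous_expI.sub continuous_const).norm.pow 2) fun t => ?_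
  exact pow_ne_zero _ (norm_ne_zero_iff.2 (expI_sub_ne_zero hz t))

lemma integrable_continuous_mul {k φ : T → ℂ} (hk : Continuous k) (hφ : Integrable φ ell) :
    Integrable (fun t => k t * φ t) ell := by
  obtain ⟨C, hC⟩ := (isCompact_range hk).isBounded.exists_norm_le
  exact hφ.bdd_mul hk.aestronglyMeasurable (c := C) (.of_forall fun t => hC _ ⟨t, rfl⟩)

/-- Domination of the Poisson kernel in a Stolz region by a sum over dyadic balls. -/
lemma poissonKer_le {c δ s : ℝ} (hs : 0 < s) (hc : 0 < c) (hδ : c * s ≤ δ) :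
    ∃ N : ℕ, c * (2 ^ N * s) ≤ δ ∧ ∀ d q : ℝ, s ≤ q → d ≤ c * q →
      2 * s / q ^ 2 ≤ 8 * c ^ 2 * s / δ ^ 2 +
        ∑ j ∈ Finset.range (N + 1), if d ≤ c * (2 ^ j * s) then 8 / (4 ^ j * s) else 0 := by
  have hδ0 : 0 < δ := lt_of_lt_of_le (by positivity) hδ
  -- `N` is the last dyadic scale whose ball has radius at most `δ`.
  obtain ⟨N, hN1, hN2⟩ := exists_nat_pow_near (x := δ / (c * s)) (y := 2)
    ((one_le_div (by positivity)).2 hδ) one_lt_two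
  rw [le_div_iff₀ (by positivity)] at hN1
  rw [div_lt_iff₀ (by positivity)] at hN2
  refine ⟨N, by linarith, fun d q hq hd => ?_⟩
  have hq0 : 0 < q := hs.trans_le hq
  have hnn : ∀ j ∈ Finset.range (N + 1),
      0 ≤ if d ≤ c * (2 ^ j * s) then 8 / (4 ^ j * s) else 0 := fun j _ => by
    split_ifs <;> positivity
  by_cases hdδ : d ≤ c * (2 ^ N * s)
  · classical
    have hex : ∃ j : ℕ, d ≤ c * (2 ^ j * s) := ⟨N, hdδ⟩
    set j := Nat.find hex with hj
    have hjN : j ≤ N := Nat.find_min' hex hdδ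
    have hjs : d ≤ c * (2 ^ j * s) := Nat.find_spec hex
    -- By minimality of `j` the ball one scale below misses the point, and `d ≤ c q` then forces
    -- `2^(j-1) s < q`.
    have hqj : 2 ^ j * s ≤ 2 * q := by
      rcases Nat.eq_zero_or_pos j with h0 | h0
      · rw [h0]; linarith
      · have := Nat.find_min hex (m := j - 1) (by omega)
        obtain ⟨i, hi⟩ : ∃ i, j = i + 1 := ⟨j - 1, by omega⟩
        rw [hi] at this ⊢
        simp only [Nat.add_sub_cancel, not_le] at this
        have h5 : 2 ^ i * s < q := lt_of_mul_lt_mul_left (this.trans_le hd) hc.le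
        rw [pow_succ]; linarith
    have hle : 2 * s / q ^ 2 ≤ 8 / (4 ^ j * s) := by
      rw [div_le_div_iff₀ (by positivity) (by positivity)]
      have h6 : (2 ^ j * s) ^ 2 ≤ (2 * q) ^ 2 := by gcongr
      have h7 : ((4 : ℝ) ^ j) = (2 ^ j) ^ 2 := by rw [← pow_mul, mul_comm, pow_mul]; norm_num
      rw [h7]; nlinarith
    have := Finset.single_le_sum hnn (Finset.mem_range.2 (Nat.lt_succ_of_le hjN))
    rw [if_pos hjs] at this
    have h8 : 0 ≤ 8 * c ^ 2 * s / δ ^ 2 := by positivity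
    linarith
  · push Not at hdδ
    have h9 : δ < 2 * (c * q) := by rw [pow_succ] at hN2; nlinarith
    have : 2 * s / q ^ 2 ≤ 8 * c ^ 2 * s / δ ^ 2 := by
      rw [div_le_div_iff₀ (by positivity) (by positivity)]
      have : δ ^ 2 ≤ (2 * (c * q)) ^ 2 := by gcongr
      nlinarith
    exact this.trans (le_add_of_nonneg_right (Finset.sum_nonneg hnn))

/-! ### Lebesgue points and Fatou's theorem -/

lemma volume_eq_smul_ell : (volume : Measure T) = ENNReal.ofReal (2 * π) • ell :=
  AddCircle.volume_eq_smul_haarAddCircle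

/-- Almost every point is a Lebesgue point. -/
lemma ae_lebesguePoint {φ : T → ℂ} (hφ : Integrable φ ell) :
    ∀ᵐ θ ∂ell, ∀ ε > 0, ∃ δ > 0, ∀ r, 0 < r → r ≤ δ →
      ∫ t in Metric.closedBall θ r, ‖φ t - φ θ‖ ∂ell ≤ ε * r := by
  have hvol : Integrable φ (volume : Measure T) := by
    rw [volume_eq_smul_ell]; exact hφ.smul_measure ENNReal.ofReal_ne_top
  have key := IsUnifLocDoublingMeasure.ae_tendsto_average_norm_sub
    (μ := (volume : Measure T)) hvol.locallyIntegrable 1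
  have hac : ell ≪ (volume : Measure T) := fun s hs => by
    rw [volume_eq_smul_ell, Measure.smul_apply, smul_eq_mul, mul_eq_zero] at hs
    exact hs.resolve_left (by simp [Real.pi_pos])
  filter_upwards [hac.ae_le key] with θ hθ ε hε
  have h1 := hθ (l := 𝓝[>] (0 : ℝ)) (fun _ => θ) (fun r => r) tendsto_id (by
    filter_upwards [self_mem_nhdsWithin] with r hr
    exact Metric.mem_closedBall_self (by simpa using hr.le))
  have h2 := h1.eventually (gt_mem_nhds hε)
  rw [eventually_nhdsWithin_iff, Metric.eventually_nhds_iff] at h2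
  obtain ⟨δ, hδ, h3⟩ := h2
  refine ⟨δ / 2, by positivity, fun r hr hrδ => ?_⟩
  have h4 := h3 (y := r) (by rw [Real.dist_eq, sub_zero, abs_of_pos hr]; linarith) hr
  rw [setAverage_eq, volume_eq_smul_ell, Measure.restrict_smul,
    integral_smul_measure, ← volume_eq_smul_ell, Measure.real, AddCircle.volume_closedBall,
    smul_eq_mul, smul_eq_mul, ENNReal.toReal_ofReal Real.two_pi_pos.le,
    ENNReal.toReal_ofReal (le_min Real.two_pi_pos.le (by linarith))] at h4
  have hm : 0 < min (2 * π) (2 * r) := lt_min Real.two_pi_pos (by linarith)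
  rw [inv_mul_lt_iff₀ hm] at h4
  have h5 : min (2 * π) (2 * r) ≤ 2 * r := min_le_right _ _
  have hI : 0 ≤ ∫ t in Metric.closedBall θ r, ‖φ t - φ θ‖ ∂ell :=
    integral_nonneg fun _ => norm_nonneg _
  nlinarith [Real.pi_gt_three]

/-- At a Lebesgue point the dyadic domination of the kernel bounds the integral of `|φ - φ θ|` by a
geometric series of small ball averages plus a far term of order `1 - ‖z‖`. The normalization of the
kernel is a hypothesis because it is derived below from the Cauchy integral. -/
lemma ae_hasNontangentialLimit_poissonInt_of_integral_eq_one {φ : T → ℂ}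
    (hφ : Integrable φ ell) (hone : ∀ z : ℂ, ‖z‖ < 1 → ∫ t, poissonKer z t ∂ell = 1) :
    ∀ᵐ θ ∂ell, HasNontangentialLimit (poissonInt φ) θ (φ θ) := by
  filter_upwards [ae_lebesguePoint hφ] with θ hθ α hα
  -- The factor `π / 2` compares arcs with chords; in the Stolz region `|ξ - e^{iθ}| ≤ (1 + α) |ξ -
  -- z|` for every `ξ` on the circle.
  set c : ℝ := π / 2 * (1 + α) with hc_def
  have hc : 0 < c := by positivity
  have hψ : Integrable (fun t => ‖φ t - φ θ‖) ell := (hφ.sub (integrable_const _)).norm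
  set A : ℝ := ∫ t, ‖φ t - φ θ‖ ∂ell with hA
  have hA0 : 0 ≤ A := integral_nonneg fun _ => norm_nonneg _
  rw [Metric.tendsto_nhds]
  intro ε hε
  -- With this constant the `j`-th ball contributes at most `(ε / 8) 2^{-j}`, in total at most `ε /
  -- 4`.
  obtain ⟨δ, hδ, hδε⟩ := hθ (ε / (64 * c)) (by positivity)
  have hs : Tendsto (fun z : ℂ => 1 - ‖z‖) (𝓝[stolzRegion α θ] (expI θ)) (𝓝 0) := by
    have : ContinuousAt (fun z : ℂ => 1 - ‖z‖) (expI θ) := by fun_prop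
    simpa [ContinuousAt, norm_expI] using this.tendsto.mono_left nhdsWithin_le_nhds
  have hs1 := hs.eventually (gt_mem_nhds (show 0 < δ / c by positivity))
  have hs2 := hs.eventually (gt_mem_nhds
    (show 0 < ε / (2 * (8 * c ^ 2 / δ ^ 2 * A + 1)) by positivity))
  filter_upwards [hs1, hs2, self_mem_nhdsWithin] with z hz1 hz2 hz
  obtain ⟨hzn, hzα⟩ := hz
  set s := 1 - ‖z‖ with hs_def
  have hs0 : 0 < s := sub_pos.2 hzn
  rw [lt_div_iff₀ hc] at hz1
  obtain ⟨N, hN, hbound⟩ := poissonKer_le hs0 hc (δ := δ) (by linarith)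
  have hker : ∀ t, poissonKer z t ≤ 8 * c ^ 2 * s / δ ^ 2 +
      ∑ j ∈ Finset.range (N + 1), if dist t θ ≤ c * (2 ^ j * s) then 8 / (4 ^ j * s) else 0 := by
    intro t
    have hq : s ≤ ‖expI t - z‖ := one_sub_norm_le z t
    have hd : dist t θ ≤ c * ‖expI t - z‖ := by
      have h1 := dist_le_norm_expI_sub t θ
      have h2 : ‖expI t - expI θ‖ ≤ ‖expI t - z‖ + ‖z - expI θ‖ :=
        norm_sub_le_norm_sub_add_norm_sub _ _ _
      have h3 : ‖expI t - expI θ‖ ≤ (1 + α) * ‖expI t - z‖ := by nlinarith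
      rw [hc_def, mul_assoc]
      have h4 := h1.trans h3
      rw [div_mul_eq_mul_div, div_le_iff₀ Real.pi_pos] at h4
      linarith
    refine le_trans ?_ (hbound _ _ hq hd)
    unfold poissonKer
    gcongr
    nlinarith [norm_nonneg z]
  have hdiff : poissonInt φ z - φ θ = ∫ t, (poissonKer z t : ℂ) * (φ t - φ θ) ∂ell := by
    have hcont : Continuous fun t => (poissonKer z t : ℂ) :=
      Complex.continuous_ofReal.comp (continuous_poissonKer hzn)
    simp_rw [mul_sub]
    rw [integral_sub (integrable_continuous_mul hcont hφ)
      (integrable_continuous_mul hcont (integrable_const _)), integral_mul_const,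
      integral_complex_ofReal, hone z hzn]
    simp [poissonInt]
  have hball : ∀ j : ℕ, Integrable (fun t => if dist t θ ≤ c * (2 ^ j * s) then
      8 / (4 ^ j * s) * ‖φ t - φ θ‖ else 0) ell := fun j =>
    ((hψ.const_mul (8 / (4 ^ j * s))).indicator
      (Metric.isClosed_closedBall (x := θ) (ε := c * (2 ^ j * s))).measurableSet)
  rw [dist_eq_norm, hdiff]
  calc ‖∫ t, (poissonKer z t : ℂ) * (φ t - φ θ) ∂ell‖
      ≤ ∫ t, (8 * c ^ 2 * s / δ ^ 2 * ‖φ t - φ θ‖ + ∑ j ∈ Finset.range (N + 1),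
          if dist t θ ≤ c * (2 ^ j * s) then 8 / (4 ^ j * s) * ‖φ t - φ θ‖ else 0) ∂ell := by
        refine norm_integral_le_of_norm_le
          ((hψ.const_mul _).add (integrable_finsetSum _ fun j _ => hball j)) (.of_forall fun t => ?_)
        rw [norm_mul, Complex.norm_real, Real.norm_of_nonneg (poissonKer_nonneg hzn t)]
        refine (mul_le_mul_of_nonneg_right (hker t) (norm_nonneg _)).trans_eq ?_
        rw [add_mul, Finset.sum_mul]
        simp only [ite_mul, zero_mul]
    _ = 8 * c ^ 2 * s / δ ^ 2 * A + ∑ j ∈ Finset.range (N + 1),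
          8 / (4 ^ j * s) * ∫ t in Metric.closedBall θ (c * (2 ^ j * s)), ‖φ t - φ θ‖ ∂ell := by
        rw [integral_add (hψ.const_mul _) (integrable_finsetSum _ fun j _ => hball j),
          integral_const_mul, integral_finsetSum _ fun j _ => hball j]
        congr 1
        refine Finset.sum_congr rfl fun j _ => ?_
        rw [← integral_const_mul, ← integral_indicator Metric.isClosed_closedBall.measurableSet]
        rfl
    _ ≤ 8 * c ^ 2 * s / δ ^ 2 * A + ∑ j ∈ Finset.range (N + 1), ε / 8 * (1 / 2) ^ j := by
        refine add_le_add_right (Finset.sum_le_sum fun j hj => ?_) _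
        have hjN : j ≤ N := Nat.lt_succ_iff.1 (Finset.mem_range.1 hj)
        have hr : c * (2 ^ j * s) ≤ δ := by
          refine le_trans ?_ hN
          gcongr
          norm_num
        refine (mul_le_mul_of_nonneg_left (hδε _ (by positivity) hr) (by positivity)).trans_eq ?_
        have h7 : ((4 : ℝ) ^ j) = 2 ^ j * 2 ^ j := by rw [← mul_pow]; norm_num
        rw [h7, one_div, inv_pow]
        field_simp
        norm_num
    _ < ε := by
        rw [← Finset.mul_sum]
        have h8 : ∑ j ∈ Finset.range (N + 1), (1 / 2 : ℝ) ^ j ≤ 2 := sum_geometric_two_le _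
        have h9 : 8 * c ^ 2 * s / δ ^ 2 * A ≤ ε / 2 := by
          rw [lt_div_iff₀ (by positivity)] at hz2
          have : 8 * c ^ 2 * s / δ ^ 2 * A = s * (8 * c ^ 2 / δ ^ 2 * A) := by ring
          nlinarith
        nlinarith

/-! ### Calculus of nontangential limits -/

lemma neBot_stolzRegion {α : ℝ} (hα : 1 < α) (θ : T) :
    (𝓝[stolzRegion α θ] (expI θ)).NeBot := by
  have h : Tendsto (fun r : ℝ => (r : ℂ) * expI θ) (𝓝[<] 1) (𝓝[stolzRegion α θ] (expI θ)) := by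
    refine tendsto_nhdsWithin_iff.2 ⟨?_, ?_⟩
    · have : Continuous fun r : ℝ => (r : ℂ) * expI θ := by fun_prop
      simpa using (this.tendsto 1).mono_left nhdsWithin_le_nhds
    · filter_upwards [Ioo_mem_nhdsLT (show (0 : ℝ) < 1 by norm_num)] with r hr
      have h1 : ‖(r : ℂ) * expI θ‖ = r := by
        rw [norm_mul, norm_expI, mul_one, Complex.norm_real, Real.norm_of_nonneg hr.1.le]
      have h2 : ‖(r : ℂ) * expI θ - expI θ‖ = 1 - r := by
        rw [← sub_one_mul, norm_mul, norm_expI, mul_one, ← Complex.ofReal_one,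
          ← Complex.ofReal_sub, Complex.norm_real, Real.norm_eq_abs, abs_sub_comm,
          abs_of_pos (by linarith [hr.2])]
      refine ⟨by rw [h1]; exact hr.2, ?_⟩
      rw [h1, h2]
      nlinarith [hr.2]
  exact h.neBot

lemma HasNontangentialLimit.unique {F : ℂ → ℂ} {θ : T} {a b : ℂ}
    (ha : HasNontangentialLimit F θ a) (hb : HasNontangentialLimit F θ b) : a = b :=
  haveI := neBot_stolzRegion one_lt_two θ
  tendsto_nhds_unique (ha 2 one_lt_two) (hb 2 one_lt_two)

lemma HasNontangentialLimit.boundaryValue_eq {F : ℂ → ℂ} {θ : T} {b : ℂ}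
    (hb : HasNontangentialLimit F θ b) : boundaryValue F θ = b := by
  have h : ∃ b, HasNontangentialLimit F θ b := ⟨b, hb⟩
  rw [boundaryValue, dif_pos h]
  exact h.choose_spec.unique hb

lemma HasNontangentialLimit.mul {F G : ℂ → ℂ} {θ : T} {a b : ℂ}
    (ha : HasNontangentialLimit F θ a) (hb : HasNontangentialLimit G θ b) :
    HasNontangentialLimit (fun z => F z * G z) θ (a * b) :=
  fun α hα => (ha α hα).mul (hb α hα)

lemma HasNontangentialLimit.div {F G : ℂ → ℂ} {θ : T} {a b : ℂ}
    (ha : HasNontangentialLimit F θ a) (hb : HasNontangentialLimit G θ b) (hb0 : b ≠ 0) :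
    HasNontangentialLimit (fun z => F z / G z) θ (a / b) :=
  fun α hα => (ha α hα).div (hb α hα) hb0

lemma HasNontangentialLimit.congr {F G : ℂ → ℂ} {θ : T} {a : ℂ}
    (ha : HasNontangentialLimit F θ a) (h : ∀ z, ‖z‖ < 1 → F z = G z) :
    HasNontangentialLimit G θ a := fun α hα =>
  (ha α hα).congr' (by filter_upwards [self_mem_nhdsWithin] with z hz using h z hz.1)

/-! ### Fourier coefficients, Cauchy and Poisson integrals -/

lemma fourier_eq_expI_zpow (n : ℤ) (t : T) : fourier n t = expI t ^ n := by
  rw [fourier_apply, AddCircle.toCircle_zsmul, Circle.coe_zpow, expI]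

lemma integral_fourier (n : ℤ) : ∫ t : T, fourier n t ∂ell = if n = 0 then 1 else 0 := by
  split_ifs with h
  · simp [h]
  · exact integral_eq_zero_of_add_right_eq_neg
      (fun t => fourier_add_half_inv_index h Real.two_pi_pos t)

lemma conj_expI (t : T) : conj (expI t) = (expI t)⁻¹ := by
  rw [expI, ← Circle.coe_inv_eq_conj, Circle.coe_inv]

/-- The geometric series of a contraction may be integrated termwise. -/
lemma hasSum_integral_pow_mul {k φ : T → ℂ} {ρ : ℝ} (hk : Continuous k) (hρ0 : 0 ≤ ρ) (hρ : ρ < 1)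
    (hkρ : ∀ t, ‖k t‖ = ρ) (hφ : Integrable φ ell) :
    HasSum (fun n : ℕ => ∫ t, k t ^ n * φ t ∂ell) (∫ t, (1 - k t)⁻¹ * φ t ∂ell) := by
  have h := hasSum_integral_of_summable_integral_norm (μ := ell)
    (F := fun (n : ℕ) t => k t ^ n * φ t)
    (fun n => integrable_continuous_mul (hk.pow n) hφ) (by
      simp_rw [norm_mul, norm_pow, hkρ, integral_const_mul]
      exact (summable_geometric_of_lt_one hρ0 hρ).mul_right _)
  have h2 : ∀ t, ∑' n : ℕ, k t ^ n * φ t = (1 - k t)⁻¹ * φ t := fun t => by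
    rw [tsum_mul_right, tsum_geometric_of_norm_lt_one (by rwa [hkρ])]
  simpa only [h2] using h

/-- The Cauchy integral of `φ`. -/
def cauchyInt (φ : T → ℂ) (z : ℂ) : ℂ := ∫ t, (1 - z / expI t)⁻¹ * φ t ∂ell

lemma hasSum_cauchyInt {φ : T → ℂ} (hφ : Integrable φ ell) {z : ℂ} (hz : ‖z‖ < 1) :
    HasSum (fun n : ℕ => fourierCoeff φ n * z ^ n) (cauchyInt φ z) := by
  have h := hasSum_integral_pow_mul (k := fun t => z / expI t) (ρ := ‖z‖)
    (continuous_const.div continuous_expI expI_ne_zero) (norm_nonneg z) hz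
    (fun t => by rw [norm_div, norm_expI, div_one]) hφ
  have h2 : ∀ n : ℕ, fourierCoeff φ n * z ^ n = ∫ t, (z / expI t) ^ n * φ t ∂ell := fun n => ?_
  · simpa only [h2, cauchyInt] using h
  rw [fourierCoeff, ← integral_mul_const]
  refine integral_congr_ae (.of_forall fun t => ?_)
  simp only [fourier_eq_expI_zpow, zpow_neg, zpow_natCast, smul_eq_mul]
  rw [div_pow]
  ring

lemma poissonKer_eq {z : ℂ} (hz : ‖z‖ < 1) (t : T) :
    (poissonKer z t : ℂ) = (1 - z / expI t)⁻¹ + (1 - conj z * expI t)⁻¹ - 1 := by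
  have h0 := expI_ne_zero t
  have h1 := expI_sub_ne_zero hz t
  have h2 : conj (expI t - z) ≠ 0 := (map_ne_zero _).2 h1
  rw [map_sub, conj_expI] at h2
  have h3 : 1 - conj z * expI t ≠ 0 := by
    intro h
    apply h2
    field_simp
    linear_combination h
  have h4 : (1 - z / expI t) ≠ 0 := by
    intro h
    apply h1
    field_simp at h
    linear_combination h
  rw [poissonKer]
  push_cast
  rw [← Complex.mul_conj', ← Complex.mul_conj', map_sub, conj_expI]
  field_simp
  ring

/-- If the Fourier coefficients of negative index vanish, the Poisson and Cauchy integrals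
coincide. -/
lemma poissonInt_eq_cauchyInt {φ : T → ℂ} (hφ : Integrable φ ell)
    (hneg : ∀ n : ℤ, n < 0 → fourierCoeff φ n = 0) {z : ℂ} (hz : ‖z‖ < 1) :
    poissonInt φ z = cauchyInt φ z := by
  have hk : Continuous fun t => conj z * expI t := continuous_const.mul continuous_expI
  have hkρ : ∀ t, ‖conj z * expI t‖ = ‖z‖ := fun t => by
    rw [norm_mul, norm_expI, mul_one, RCLike.norm_conj]
  have h := hasSum_integral_pow_mul hk (norm_nonneg z) hz hkρ hφ
  -- The antianalytic half of the kernel sees only the coefficients of index `-n`, so just `n = 0`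
  -- survives.
  have h' : HasSum (fun n : ℕ => ∫ t, (conj z * expI t) ^ n * φ t ∂ell) (∫ t, φ t ∂ell) := by
    convert hasSum_single (f := fun n : ℕ => ∫ t, (conj z * expI t) ^ n * φ t ∂ell) 0 ?_ using 1
    · simp
    · intro n hn
      have h1 := hneg (-n) (by omega)
      rw [fourierCoeff] at h1
      simp only [fourier_eq_expI_zpow, neg_neg, zpow_natCast, smul_eq_mul] at h1
      simp_rw [mul_pow, mul_assoc, integral_const_mul]
      rw [h1, mul_zero]
  have h2 := h.unique h'
  have hne : ∀ k : ℂ, ‖k‖ = ‖z‖ → 1 - k ≠ 0 := fun k hk h => by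
    rw [sub_eq_zero] at h
    rw [← hk, ← h, norm_one] at hz
    exact lt_irrefl _ hz
  have hi1 : Integrable (fun t => (1 - z / expI t)⁻¹ * φ t) ell :=
    integrable_continuous_mul ((continuous_const.sub
      (continuous_const.div continuous_expI expI_ne_zero)).inv₀
      fun t => hne (z / expI t) (by rw [norm_div, norm_expI, div_one])) hφ
  have hi2 : Integrable (fun t => (1 - conj z * expI t)⁻¹ * φ t) ell :=
    integrable_continuous_mul ((continuous_const.sub hk).inv₀ fun t => hne _ (hkρ t)) hφ
  rw [poissonInt, cauchyInt]
  simp_rw [poissonKer_eq hz, sub_mul, add_mul, one_mul]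
  have h3 := integral_sub (hi1.add hi2) hφ
  have h4 := integral_add hi1 hi2
  simp only [Pi.add_apply] at h3 h4
  rw [h3, h4, h2, add_sub_cancel_right]

lemma integral_poissonKer {z : ℂ} (hz : ‖z‖ < 1) : ∫ t, poissonKer z t ∂ell = 1 := by
  have hcoeff : ∀ n : ℤ, fourierCoeff (fun _ : T => (1 : ℂ)) n = if n = 0 then 1 else 0 := by
    intro n
    simp only [fourierCoeff, smul_eq_mul, mul_one, integral_fourier, neg_eq_zero]
  have h1 := poissonInt_eq_cauchyInt (integrable_const (μ := ell) (1 : ℂ))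
    (fun n hn => by rw [hcoeff, if_neg hn.ne]) hz
  have h2 := (hasSum_cauchyInt (integrable_const (μ := ell) (1 : ℂ)) hz).unique
    (hasSum_single 0 fun n hn => by rw [hcoeff, if_neg (by exact_mod_cast hn), zero_mul])
  rw [h2, hcoeff, poissonInt] at h1
  simp_rw [mul_one] at h1
  rw [integral_complex_ofReal] at h1
  simpa using h1

/-- **Fatou's theorem**: the Poisson integral of an integrable function converges
nontangentially to it almost everywhere. -/
theorem ae_hasNontangentialLimit_poissonInt {φ : T → ℂ} (hφ : Integrable φ ell) :
    ∀ᵐ θ ∂ell, HasNontangentialLimit (poissonInt φ) θ (φ θ) :=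
  ae_hasNontangentialLimit_poissonInt_of_integral_eq_one hφ fun _ => integral_poissonKer

/-! ### Boundary values of bounded analytic functions -/

lemma MemH2.integrable {g : T → ℂ} (hg : MemH2 g) : Integrable g ell :=
  hg.1.integrable (by norm_num)

lemma MemH2.poissonInt_eq {g : T → ℂ} (hg : MemH2 g) {z : ℂ} (hz : ‖z‖ < 1) :
    poissonInt g z = cauchyInt g z := poissonInt_eq_cauchyInt hg.integrable hg.2 hz

/-- A square integrable function on the circle with prescribed square summable Taylor
coefficients. -/
lemma exists_memH2_fourierCoeff {a : ℕ → ℂ} (ha : Summable fun n => ‖a n‖ ^ 2) :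
    ∃ b : T → ℂ, MemH2 b ∧ ∀ n : ℕ, fourierCoeff b n = a n := by
  let c : ℤ → ℂ := fun n => if 0 ≤ n then a n.toNat else 0
  have hc : Memℓp c 2 := by
    refine memℓp_gen ?_
    have hinj : Function.Injective (Nat.cast : ℕ → ℤ) := Nat.cast_injective
    rw [← hinj.summable_iff]
    · simpa [c, Function.comp_def] using ha
    · intro n hn
      have : ¬ 0 ≤ n := fun h => hn ⟨n.toNat, Int.toNat_of_nonneg h⟩
      simp [c, this]
  let b := (fourierBasis (T := 2 * π)).repr.symm ⟨c, hc⟩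
  have hb : ∀ n : ℤ, fourierCoeff b n = c n := fun n => by
    rw [← fourierBasis_repr, LinearIsometryEquiv.apply_symm_apply]
  exact ⟨b, ⟨Lp.memLp b, fun n hn => by rw [hb]; simp [c, hn]⟩, fun n => by rw [hb]; simp [c]⟩

/-- The Taylor coefficients of a bounded function on the disk are square summable. -/
lemma summable_sq_of_bounded {B : ℂ → ℂ} {a : ℕ → ℂ} {C : ℝ}
    (hB : ∀ z : ℂ, ‖z‖ < 1 → HasSum (fun n => a n * z ^ n) (B z))
    (hC : ∀ z : ℂ, ‖z‖ < 1 → ‖B z‖ ≤ C) : Summable fun n => ‖a n‖ ^ 2 := by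
  -- Parseval on the circle of radius `r`. Keeping the sum finite makes the passage `r → 1` a matter
  -- of continuity.
  have hr : ∀ r ∈ Set.Ioo (0 : ℝ) 1, ∀ N, ∑ n ∈ Finset.range N, ‖a n * (r : ℂ) ^ n‖ ^ 2 ≤ C ^ 2 := by
    intro r hr N
    have hrn : ‖(r : ℂ)‖ = r := by rw [Complex.norm_real, Real.norm_of_nonneg hr.1.le]
    have hrξ : ∀ t, ‖(r : ℂ) * expI t‖ < 1 := fun t => by
      rw [norm_mul, hrn, norm_expI, mul_one]; exact hr.2
    have hsum : Summable fun n => ‖a n * (r : ℂ) ^ n‖ :=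
      (hB r (by rw [hrn]; exact hr.2)).summable.norm
    let f : T → ℂ := fun t => ∑' n, a n * (r * expI t) ^ n
    have hfB : ∀ t, f t = B (r * expI t) := fun t => (hB _ (hrξ t)).tsum_eq
    have hterm : ∀ n t, ‖a n * (r * expI t) ^ n‖ = ‖a n * (r : ℂ) ^ n‖ := fun n t => by
      rw [mul_pow, ← mul_assoc, norm_mul _ (expI t ^ n), norm_pow (expI t), norm_expI, one_pow,
        mul_one]
    have hf : Continuous f := continuous_tsum
      (fun n => continuous_const.mul ((continuous_const.mul continuous_expI).pow n)) hsum
      fun n t => (hterm n t).le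
    have hcoeff : ∀ m : ℕ, fourierCoeff f m = a m * (r : ℂ) ^ m := by
      intro m
      have h := hasSum_integral_of_summable_integral_norm (μ := (ell : Measure T))
        (F := fun (n : ℕ) t => fourier (-(m : ℤ)) t * (a n * (r * expI t) ^ n))
        (fun n => ((fourier _).continuous.mul (continuous_const.mul
          ((continuous_const.mul continuous_expI).pow n))).integrable_of_hasCompactSupport
            (HasCompactSupport.of_compactSpace _)) (by
          simp_rw [norm_mul (fourier _ _), hterm, fourier_eq_expI_zpow, norm_zpow, norm_expI,
            one_zpow, one_mul]
          simpa using hsum)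
      have h2 : ∀ n : ℕ, ∫ t : T, fourier (-(m : ℤ)) t * (a n * (r * expI t) ^ n) ∂ell =
          if n = m then a m * (r : ℂ) ^ m else 0 := by
        intro n
        have h3 : ∀ t : T, fourier (-(m : ℤ)) t * (a n * (r * expI t) ^ n) =
            a n * r ^ n * fourier ((n : ℤ) - m) t := fun t => by
          rw [fourier_eq_expI_zpow, fourier_eq_expI_zpow, sub_eq_add_neg,
            zpow_add₀ (expI_ne_zero t), zpow_natCast, mul_pow]
          ring
        simp_rw [h3]
        rw [integral_const_mul, integral_fourier]
        split_ifs with h4 h5 h5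
        · rw [h5, mul_one]
        · omega
        · omega
        · rw [mul_zero]
      simp_rw [h2, tsum_mul_left] at h
      exact h.unique (hasSum_ite_eq m _)
    have hfL : MemLp f 2 (ell : Measure T) := hf.memLp_of_hasCompactSupport
      (HasCompactSupport.of_compactSpace _)
    have hP := hasSum_sq_fourierCoeff (hfL.toLp f)
    simp_rw [fourierCoeff_congr_ae hfL.coeFn_toLp] at hP
    have hle := sum_le_hasSum ((Finset.range N).map Nat.castEmbedding)
      (fun _ _ => sq_nonneg _) hP
    rw [Finset.sum_map] at hle
    simp only [Nat.castEmbedding_apply, hcoeff] at hle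
    refine hle.trans ?_
    calc ∫ t, ‖hfL.toLp f t‖ ^ 2 ∂ell = ∫ t, ‖f t‖ ^ 2 ∂ell := by
          refine integral_congr_ae ?_
          filter_upwards [hfL.coeFn_toLp] with t ht
          rw [ht]
      _ ≤ ∫ _, C ^ 2 ∂(ell : Measure T) := by
          refine integral_mono_of_nonneg (.of_forall fun _ => sq_nonneg _)
            (integrable_const _) (.of_forall fun t => ?_)
          simp only [hfB]
          gcongr
          exact hC _ (hrξ t)
      _ = C ^ 2 := by simp
  refine summable_of_sum_range_le (c := C ^ 2) (fun _ => sq_nonneg _) fun N => ?_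
  have hcont : Continuous fun r : ℝ => ∑ n ∈ Finset.range N, ‖a n * (r : ℂ) ^ n‖ ^ 2 := by
    fun_prop
  have hlim := (hcont.tendsto 1).mono_left (nhdsWithin_le_nhds (s := Set.Iio 1))
  have h1 : ∑ n ∈ Finset.range N, ‖a n * ((1 : ℝ) : ℂ) ^ n‖ ^ 2 =
      ∑ n ∈ Finset.range N, ‖a n‖ ^ 2 := by simp
  rw [← h1]
  refine le_of_tendsto hlim ?_
  filter_upwards [Ioo_mem_nhdsLT (show (0 : ℝ) < 1 by norm_num)] with r hr' using hr r hr' N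

/-- A bounded analytic function on the disk has nontangential limits almost everywhere, and its
boundary function lies in the Hardy space. -/
theorem exists_boundary_of_bounded {B : ℂ → ℂ} {C : ℝ}
    (hB : DifferentiableOn ℂ B (Metric.ball 0 1)) (hC : ∀ z : ℂ, ‖z‖ < 1 → ‖B z‖ ≤ C) :
    ∃ b : T → ℂ, MemH2 b ∧ (∀ᵐ θ ∂ell, HasNontangentialLimit B θ (b θ)) ∧
      ∫ t, b t ∂ell = B 0 := by
  have hs : ∀ z : ℂ, ‖z‖ < 1 →
      HasSum (fun n : ℕ => ((n.factorial : ℂ)⁻¹ * iteratedDeriv n B 0) * z ^ n) (B z) := by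
    intro z hz
    have h := Complex.hasSum_taylorSeries_on_ball (r := 1) (by simpa using hB)
      (z := z) (by simpa using hz)
    have h2 : ∀ n : ℕ, (n.factorial : ℂ)⁻¹ • (z - 0) ^ n • iteratedDeriv n B 0 =
        ((n.factorial : ℂ)⁻¹ * iteratedDeriv n B 0) * z ^ n := fun n => by
      rw [sub_zero, smul_eq_mul, smul_eq_mul]
      ring
    simpa only [h2] using h
  obtain ⟨b, hb, hba⟩ := exists_memH2_fourierCoeff (summable_sq_of_bounded hs hC)
  have hP : ∀ z : ℂ, ‖z‖ < 1 → poissonInt b z = B z := fun z hz => by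
    rw [hb.poissonInt_eq hz]
    have h := hasSum_cauchyInt hb.integrable hz
    simp_rw [hba] at h
    exact h.unique (hs z hz)
  refine ⟨b, hb, ?_, ?_⟩
  · filter_upwards [ae_hasNontangentialLimit_poissonInt hb.integrable] with θ hθ using hθ.congr hP
  · rw [← hP 0 (by simp), poissonInt]
    simp [poissonKer, norm_expI]

/-! ### Outer functions and their boundary values -/

/-- The outer function on the disk whose modulus on the circle has logarithm `φ`. -/
def outerExp (φ : T → ℝ) (z : ℂ) : ℂ :=
  Complex.exp (∫ θ, (expI θ + z) / (expI θ - z) * (φ θ : ℂ) ∂ell)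

/-- The boundary function of `outerExp φ`. -/
def outerBdry (φ : T → ℝ) : T → ℂ := boundaryValue (outerExp φ)

lemma herglotz_eq {z : ℂ} (hz : ‖z‖ < 1) (t : T) :
    (expI t + z) / (expI t - z) = 2 * (1 - z / expI t)⁻¹ - 1 := by
  have h0 := expI_ne_zero t
  have h1 := expI_sub_ne_zero hz t
  have h4 : 1 - z / expI t ≠ 0 := by
    intro h
    apply h1
    field_simp at h
    linear_combination h
  field_simp
  ring

lemma re_herglotz {z : ℂ} (hz : ‖z‖ < 1) (t : T) :
    ((expI t + z) / (expI t - z)).re = poissonKer z t := by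
  have h : ((2 * ((expI t + z) / (expI t - z)).re : ℝ) : ℂ) = ((2 * poissonKer z t : ℝ) : ℂ) := by
    push_cast
    rw [poissonKer_eq hz, Complex.re_eq_add_conj, herglotz_eq hz]
    simp only [map_sub, map_mul, map_inv₀, map_one, map_div₀, conj_expI, Complex.conj_ofNat]
    rw [div_inv_eq_mul]
    ring
  have := Complex.ofReal_injective h
  linarith

lemma continuous_herglotz {z : ℂ} (hz : ‖z‖ < 1) :
    Continuous fun t : T => (expI t + z) / (expI t - z) :=
  (continuous_expI.add continuous_const).div (continuous_expI.sub continuous_const)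
    (expI_sub_ne_zero hz)

lemma integrable_herglotz_mul {φ : T → ℝ} (hφ : Integrable φ ell) {z : ℂ} (hz : ‖z‖ < 1) :
    Integrable (fun t => (expI t + z) / (expI t - z) * (φ t : ℂ)) ell :=
  integrable_continuous_mul (continuous_herglotz hz) hφ.ofReal

lemma differentiableOn_cauchyInt {φ : T → ℂ} (hφ : Integrable φ ell) :
    DifferentiableOn ℂ (cauchyInt φ) (Metric.ball 0 1) := by
  intro z hz
  rw [mem_ball_zero_iff] at hz
  obtain ⟨r, hzr, hr⟩ := exists_between hz
  have hr0 : 0 < r := (norm_nonneg z).trans_lt hzr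
  have hrn : ‖(r : ℂ)‖ = r := by rw [Complex.norm_real, Real.norm_of_nonneg hr0.le]
  have hsum := (hasSum_cauchyInt hφ (z := r) (by rwa [hrn])).summable.norm
  have hd : DifferentiableOn ℂ (fun w => ∑' n : ℕ, fourierCoeff φ n * w ^ n)
      (Metric.ball 0 r) := by
    refine Complex.differentiableOn_tsum_of_summable_norm hsum (fun n => by fun_prop)
      Metric.isOpen_ball fun n w hw => ?_
    rw [mem_ball_zero_iff] at hw
    rw [norm_mul, norm_mul, norm_pow, norm_pow, hrn]
    gcongr
  have hd2 : DifferentiableOn ℂ (cauchyInt φ) (Metric.ball 0 r) := hd.congr fun w hw =>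
    ((hasSum_cauchyInt hφ ((mem_ball_zero_iff.1 hw).trans hr)).tsum_eq).symm
  exact (hd2.differentiableAt (Metric.isOpen_ball.mem_nhds
    (mem_ball_zero_iff.2 hzr))).differentiableWithinAt

lemma differentiableOn_outerExp {φ : T → ℝ} (hφ : Integrable φ ell) :
    DifferentiableOn ℂ (outerExp φ) (Metric.ball 0 1) := by
  have h : DifferentiableOn ℂ
      (fun z => Complex.exp (2 * cauchyInt (fun t => (φ t : ℂ)) z - ∫ t, (φ t : ℂ) ∂ell))
      (Metric.ball 0 1) :=
    (((differentiableOn_cauchyInt hφ.ofReal).const_mul 2).sub_const _).cexp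
  refine h.congr fun z hz => ?_
  rw [mem_ball_zero_iff] at hz
  have hne : ∀ t : T, 1 - z / expI t ≠ 0 := fun t h => by
    rw [sub_eq_zero] at h
    have : ‖z / expI t‖ = ‖z‖ := by rw [norm_div, norm_expI, div_one]
    rw [← h, norm_one] at this
    linarith
  rw [outerExp, cauchyInt, ← integral_const_mul, ← integral_sub]
  · congr 1
    refine integral_congr_ae (.of_forall fun t => ?_)
    simp only [herglotz_eq hz]
    ring
  · exact (integrable_continuous_mul ((continuous_const.sub
      (continuous_const.div continuous_expI expI_ne_zero)).inv₀ hne) hφ.ofReal).const_mul 2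
  · exact hφ.ofReal

lemma poissonInt_ofReal (φ : T → ℝ) (z : ℂ) :
    poissonInt (fun t => (φ t : ℂ)) z = ((∫ t, poissonKer z t * φ t ∂ell : ℝ) : ℂ) := by
  rw [poissonInt, ← integral_complex_ofReal]
  push_cast
  rfl

lemma norm_outerExp {φ : T → ℝ} (hφ : Integrable φ ell) {z : ℂ} (hz : ‖z‖ < 1) :
    ‖outerExp φ z‖ = Real.exp (∫ t, poissonKer z t * φ t ∂ell) := by
  have h := integral_re (integrable_herglotz_mul hφ hz)
  simp only [RCLike.re_to_complex, Complex.re_mul_ofReal, re_herglotz hz] at h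
  rw [outerExp, Complex.norm_exp, ← h]

lemma outerExp_ne_zero (φ : T → ℝ) (z : ℂ) : outerExp φ z ≠ 0 := Complex.exp_ne_zero _

lemma outerExp_add {φ ψ : T → ℝ} (hφ : Integrable φ ell) (hψ : Integrable ψ ell) {z : ℂ}
    (hz : ‖z‖ < 1) : outerExp (fun t => φ t + ψ t) z = outerExp φ z * outerExp ψ z := by
  rw [outerExp, outerExp, outerExp, ← Complex.exp_add,
    ← integral_add (integrable_herglotz_mul hφ hz) (integrable_herglotz_mul hψ hz)]
  congr 2
  ext t
  push_cast
  ring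

lemma norm_outerExp_le {φ : T → ℝ} (hφ : Integrable φ ell) {C : ℝ} (hC : ∀ᵐ t ∂ell, φ t ≤ C)
    {z : ℂ} (hz : ‖z‖ < 1) : ‖outerExp φ z‖ ≤ Real.exp C := by
  rw [norm_outerExp hφ hz, Real.exp_le_exp]
  have hi : Integrable (poissonKer z) (ell : Measure T) :=
    (continuous_poissonKer hz).integrable_of_hasCompactSupport (HasCompactSupport.of_compactSpace _)
  have h1 : Integrable (fun t => poissonKer z t * φ t) ell := by
    obtain ⟨C, hC⟩ := (isCompact_range (continuous_poissonKer hz)).isBounded.exists_norm_le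
    exact hφ.bdd_mul (continuous_poissonKer hz).aestronglyMeasurable (c := C)
      (.of_forall fun t => hC _ ⟨t, rfl⟩)
  calc ∫ t, poissonKer z t * φ t ∂ell ≤ ∫ t, poissonKer z t * C ∂ell := by
        refine integral_mono_ae h1 (hi.mul_const C) ?_
        filter_upwards [hC] with t ht
        exact mul_le_mul_of_nonneg_left ht (poissonKer_nonneg hz t)
    _ = C := by rw [integral_mul_const, integral_poissonKer hz, one_mul]

/-- The logarithm of the modulus is the Poisson integral of `φ`, to which Fatou's theorem applies.
-/
lemma ae_norm_limit_outerExp {φ : T → ℝ} (hφ : Integrable φ ell) :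
    ∀ᵐ θ ∂ell, ∀ b, HasNontangentialLimit (outerExp φ) θ b → ‖b‖ = Real.exp (φ θ) := by
  have hφ' : Integrable (fun t => (φ t : ℂ)) ell := hφ.ofReal
  filter_upwards [ae_hasNontangentialLimit_poissonInt hφ'] with θ hθ b hb
  have := neBot_stolzRegion one_lt_two θ
  refine tendsto_nhds_unique (hb 2 one_lt_two).norm ?_
  have h2 := Real.continuous_exp.continuousAt.tendsto.comp
    (Complex.continuous_re.continuousAt.tendsto.comp (hθ 2 one_lt_two))
  refine h2.congr' ?_
  filter_upwards [self_mem_nhdsWithin] with z hz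
  rw [norm_outerExp hφ hz.1]
  simp only [Function.comp_apply]
  rw [poissonInt_ofReal, Complex.ofReal_re]

lemma exists_boundary_outerExp {φ : T → ℝ} (hφ : Integrable φ ell) {C : ℝ}
    (hC : ∀ᵐ t ∂ell, φ t ≤ C) :
    ∃ b : T → ℂ, MemH2 b ∧ (∀ᵐ θ ∂ell, HasNontangentialLimit (outerExp φ) θ (b θ)) ∧
      ∫ t, b t ∂ell = outerExp φ 0 :=
  exists_boundary_of_bounded (differentiableOn_outerExp hφ) fun _ hz => norm_outerExp_le hφ hC hz

/-- For `φ` unbounded above the outer function need not be bounded, but `φ = min φ 0 - min (-φ) 0`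
makes it a quotient of two bounded ones, the denominator having nonzero limits almost everywhere. -/
lemma exists_measurable_boundary_outerExp {φ : T → ℝ} (hφ : Integrable φ ell) :
    ∃ b : T → ℂ, AEStronglyMeasurable b ell ∧
      ∀ᵐ θ ∂ell, HasNontangentialLimit (outerExp φ) θ (b θ) := by
  have h1 : Integrable (fun t => min (φ t) 0) ell := hφ.inf (integrable_zero _ _ _)
  have h2 : Integrable (fun t => min (-φ t) 0) ell := hφ.neg.inf (integrable_zero _ _ _)
  obtain ⟨b₁, hb₁, hl₁, -⟩ := exists_boundary_outerExp h1 (.of_forall fun t => min_le_right _ _)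
  obtain ⟨b₂, hb₂, hl₂, -⟩ := exists_boundary_outerExp h2 (.of_forall fun t => min_le_right _ _)
  refine ⟨fun t => b₁ t / b₂ t, hb₁.1.1.div₀ hb₂.1.1, ?_⟩
  filter_upwards [hl₁, hl₂, ae_norm_limit_outerExp h2] with θ hθ1 hθ2 hθ3
  have hne : b₂ θ ≠ 0 := norm_ne_zero_iff.1 (by rw [hθ3 _ hθ2]; exact (Real.exp_pos _).ne')
  refine (hθ1.div hθ2 hne).congr fun z hz => ?_
  rw [div_eq_iff (outerExp_ne_zero _ _), ← outerExp_add hφ h2 hz]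
  congr 1
  ext t
  rcases le_total (φ t) 0 with h | h
  · rw [min_eq_left h, min_eq_right (neg_nonneg.2 h), add_zero]
  · rw [min_eq_right h, min_eq_left (neg_nonpos.2 h), add_neg_cancel]

lemma ae_hasNontangentialLimit_outerExp {φ : T → ℝ} (hφ : Integrable φ ell) :
    ∀ᵐ θ ∂ell, HasNontangentialLimit (outerExp φ) θ (outerBdry φ θ) := by
  obtain ⟨b, -, hb⟩ := exists_measurable_boundary_outerExp hφ
  filter_upwards [hb] with θ hθ
  rwa [outerBdry, hθ.boundaryValue_eq]

lemma outerBdry_eq_of_limit {φ : T → ℝ} {b : T → ℂ}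
    (hb : ∀ᵐ θ ∂ell, HasNontangentialLimit (outerExp φ) θ (b θ)) : outerBdry φ =ᵐ[ell] b := by
  filter_upwards [hb] with θ hθ using hθ.boundaryValue_eq

lemma aestronglyMeasurable_outerBdry {φ : T → ℝ} (hφ : Integrable φ ell) :
    AEStronglyMeasurable (outerBdry φ) ell := by
  obtain ⟨b, hb1, hb⟩ := exists_measurable_boundary_outerExp hφ
  exact hb1.congr (outerBdry_eq_of_limit hb).symm

lemma norm_outerBdry {φ : T → ℝ} (hφ : Integrable φ ell) :
    ∀ᵐ θ ∂ell, ‖outerBdry φ θ‖ = Real.exp (φ θ) := by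
  filter_upwards [ae_hasNontangentialLimit_outerExp hφ, ae_norm_limit_outerExp hφ] with θ h1 h2
    using h2 _ h1

lemma outerBdry_add {φ ψ : T → ℝ} (hφ : Integrable φ ell) (hψ : Integrable ψ ell) :
    outerBdry (fun t => φ t + ψ t) =ᵐ[ell] fun θ => outerBdry φ θ * outerBdry ψ θ := by
  refine outerBdry_eq_of_limit ?_
  filter_upwards [ae_hasNontangentialLimit_outerExp hφ,
    ae_hasNontangentialLimit_outerExp hψ] with θ h1 h2
  exact (h1.mul h2).congr fun z hz => (outerExp_add hφ hψ hz).symm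

lemma MemH2.congr {g g' : T → ℂ} (hg : MemH2 g) (h : g =ᵐ[ell] g') : MemH2 g' :=
  ⟨hg.1.ae_eq h, fun n hn => by rw [← fourierCoeff_congr_ae h]; exact hg.2 n hn⟩

lemma memH2_outerBdry {φ : T → ℝ} (hφ : Integrable φ ell) {C : ℝ}
    (hC : ∀ᵐ t ∂ell, φ t ≤ C) : MemH2 (outerBdry φ) := by
  obtain ⟨b, hb, hl, -⟩ := exists_boundary_outerExp hφ hC
  exact hb.congr (outerBdry_eq_of_limit hl).symm

lemma norm_outerBdry_le {φ : T → ℝ} (hφ : Integrable φ ell) {C : ℝ}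
    (hC : ∀ᵐ t ∂ell, φ t ≤ C) : ∀ᵐ t ∂ell, ‖outerBdry φ t‖ ≤ Real.exp C := by
  filter_upwards [norm_outerBdry hφ, hC] with t h1 h2
  rw [h1]
  exact Real.exp_le_exp.2 h2

/-- The mean value of a bounded outer function. -/
lemma integral_outerBdry {φ : T → ℝ} (hφ : Integrable φ ell) {C : ℝ}
    (hC : ∀ᵐ t ∂ell, φ t ≤ C) :
    ∫ t, outerBdry φ t ∂ell = (Real.exp (∫ t, φ t ∂ell) : ℂ) := by
  obtain ⟨b, -, hl, hi⟩ := exists_boundary_outerExp hφ hC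
  rw [integral_congr_ae (outerBdry_eq_of_limit hl), hi, outerExp, Complex.ofReal_exp,
    ← integral_complex_ofReal]
  simp [expI_ne_zero]

/-- The distance to `1` of a bounded outer function. -/
lemma integral_norm_outerBdry_sub_one_sq {φ : T → ℝ} (hφ : Integrable φ ell) {C : ℝ}
    (hC : ∀ᵐ t ∂ell, φ t ≤ C) :
    ∫ t, ‖outerBdry φ t - 1‖ ^ 2 ∂ell =
      ∫ t, Real.exp (2 * φ t) ∂ell - 2 * Real.exp (∫ t, φ t ∂ell) + 1 := by
  have hH := memH2_outerBdry hφ hC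
  have h1 : Integrable (fun t => Real.exp (2 * φ t)) ell := by
    refine (hH.1.integrable_norm_pow (p := 2) two_ne_zero).congr ?_
    filter_upwards [norm_outerBdry hφ] with t ht
    rw [ht, ← Real.exp_nat_mul]
    norm_num
  have h2 : Integrable (fun t => 2 * (outerBdry φ t).re) ell := hH.integrable.re.const_mul 2
  have h3 : ∫ t, (outerBdry φ t).re ∂ell = Real.exp (∫ t, φ t ∂ell) := by
    have := integral_re hH.integrable
    simp only [RCLike.re_to_complex] at this
    rw [this, integral_outerBdry hφ hC, Complex.ofReal_re]
  have h4 : ∫ t, ‖outerBdry φ t - 1‖ ^ 2 ∂ell =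
      ∫ t, (Real.exp (2 * φ t) - 2 * (outerBdry φ t).re + 1) ∂ell := by
    refine integral_congr_ae ?_
    filter_upwards [norm_outerBdry hφ] with t ht
    have h5 : Real.exp (2 * φ t) = ‖outerBdry φ t‖ ^ 2 := by
      rw [ht, ← Real.exp_nat_mul]
      norm_num
    rw [h5, Complex.sq_norm, Complex.sq_norm, Complex.normSq_apply, Complex.normSq_apply]
    simp only [Complex.sub_re, Complex.sub_im, Complex.one_re, Complex.one_im]
    ring
  have h6 := integral_add (h1.sub h2) (integrable_const (μ := (ell : Measure T)) (1 : ℝ))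
  simp only [Pi.sub_apply] at h6
  rw [h4, h6, integral_sub h1 h2, integral_const_mul, h3]
  simp

/-! ### Parseval estimates and bounded multipliers -/

lemma integrable_norm_sq {X : T → ℂ} {ν : Measure T} (hX : MemLp X 2 ν) :
    Integrable (fun t => ‖X t‖ ^ 2) ν := hX.integrable_norm_pow (p := 2) two_ne_zero

lemma hasSum_sq_fourierCoeff_memLp {X : T → ℂ} (hX : MemLp X 2 ell) :
    HasSum (fun n => ‖fourierCoeff X n‖ ^ 2) (∫ t, ‖X t‖ ^ 2 ∂ell) := by
  have h := hasSum_sq_fourierCoeff (hX.toLp X)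
  simp_rw [fourierCoeff_congr_ae hX.coeFn_toLp] at h
  have h2 : ∫ t, ‖hX.toLp X t‖ ^ 2 ∂ell = ∫ t, ‖X t‖ ^ 2 ∂ell := by
    refine integral_congr_ae ?_
    filter_upwards [hX.coeFn_toLp] with t ht
    rw [ht]
  rwa [h2] at h

lemma integral_sq_le_of_fourierCoeff_le {X Y : T → ℂ} (hX : MemLp X 2 ell) (hY : MemLp Y 2 ell)
    (h : ∀ n, ‖fourierCoeff X n‖ ≤ ‖fourierCoeff Y n‖) :
    ∫ t, ‖X t‖ ^ 2 ∂ell ≤ ∫ t, ‖Y t‖ ^ 2 ∂ell :=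
  hasSum_le (fun n => by gcongr; exact h n) (hasSum_sq_fourierCoeff_memLp hX)
    (hasSum_sq_fourierCoeff_memLp hY)

lemma norm_sq_fourierCoeff_le {X : T → ℂ} (hX : MemLp X 2 ell) (n : ℤ) :
    ‖fourierCoeff X n‖ ^ 2 ≤ ∫ t, ‖X t‖ ^ 2 ∂ell :=
  le_hasSum (hasSum_sq_fourierCoeff_memLp hX) n fun _ _ => sq_nonneg _

lemma fourierCoeff_sub {X Y : T → ℂ} (hX : Integrable X ell) (hY : Integrable Y ell) (n : ℤ) :
    fourierCoeff (fun t => X t - Y t) n = fourierCoeff X n - fourierCoeff Y n := by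
  simp only [fourierCoeff, smul_sub]
  exact integral_sub (hX.fourier_smul _) (hY.fourier_smul _)

lemma memLp_bdd_mul {b X : T → ℂ} {C : ℝ} (hb : AEStronglyMeasurable b ell)
    (hC : ∀ᵐ t ∂ell, ‖b t‖ ≤ C) (hX : MemLp X 2 ell) : MemLp (fun t => b t * X t) 2 ell := by
  refine MemLp.of_le_mul (c := C) hX (hb.mul hX.1) ?_
  filter_upwards [hC] with t ht
  rw [norm_mul]
  gcongr

/-- Bounded functions of the Hardy space are multipliers of it. -/
lemma MemH2.bdd_mul {b g : T → ℂ} {C : ℝ} (hb : MemH2 b) (hC : ∀ᵐ t ∂ell, ‖b t‖ ≤ C)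
    (hg : MemH2 g) : MemH2 (fun t => b t * g t) := by
  refine ⟨memLp_bdd_mul hb.1.1 hC hg.1, fun n hn => ?_⟩
  -- The `n`-th coefficient of `b g` is `⟨x, g⟩`. Parseval expands it into products of the
  -- coefficients of `b` at `n - i` and of `g` at `i`; since `n < 0`, one of these indices is
  -- negative.
  let x : T → ℂ := fun t => conj (b t) * fourier n t
  have hx : MemLp x 2 ell := by
    refine MemLp.of_le hb.1 ((RCLike.continuous_conj.comp_aestronglyMeasurable hb.1.1).mul
      (fourier n).continuous.aestronglyMeasurable) (.of_forall fun t => ?_)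
    rw [norm_mul, RCLike.norm_conj, fourier_eq_expI_zpow, norm_zpow, norm_expI, one_zpow, mul_one]
  have h := (fourierBasis (T := 2 * π)).hasSum_inner_mul_inner (hx.toLp x) (hg.1.toLp g)
  have h1 : ∀ i, inner ℂ (hx.toLp x) (fourierBasis (T := 2 * π) i) *
      inner ℂ (fourierBasis (T := 2 * π) i) (hg.1.toLp g) = 0 := by
    intro i
    rw [← HilbertBasis.repr_apply_apply _ (hg.1.toLp g), fourierBasis_repr,
      fourierCoeff_congr_ae hg.1.coeFn_toLp]
    rcases lt_or_ge i 0 with hi | hi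
    · rw [hg.2 i hi, mul_zero]
    · have h2 : inner ℂ (hx.toLp x) (fourierBasis (T := 2 * π) i) = fourierCoeff b (n - i) := by
        rw [coe_fourierBasis, L2.inner_def, fourierCoeff]
        refine integral_congr_ae ?_
        filter_upwards [hx.coeFn_toLp, coeFn_fourierLp 2 i] with t ht1 ht2
        rw [ht1, ht2]
        simp only [x, RCLike.inner_apply, map_mul, Complex.conj_conj, smul_eq_mul]
        rw [neg_sub, sub_eq_add_neg i n, fourier_add, fourier_neg]
        ring
      rw [h2, hb.2 _ (by omega), zero_mul]
  simp_rw [h1] at h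
  have h3 := h.unique hasSum_zero
  rw [L2.inner_def] at h3
  rw [← h3, fourierCoeff]
  refine integral_congr_ae ?_
  filter_upwards [hx.coeFn_toLp, hg.1.coeFn_toLp] with t ht1 ht2
  rw [ht1, ht2]
  simp only [x, RCLike.inner_apply, map_mul, Complex.conj_conj, smul_eq_mul, fourier_neg]
  ring

/-- The part of `∫ ‖G‖²` carried by the set where `‖G‖ > N`. -/
def tailSq (G : T → ℂ) (N : ℝ) : ℝ := ∫ t, (if N < ‖G t‖ then ‖G t‖ ^ 2 else 0) ∂ell

lemma integrable_tailSq {G : T → ℂ} (hG : MemLp G 2 ell) (N : ℝ) :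
    Integrable (fun t => if N < ‖G t‖ then ‖G t‖ ^ 2 else 0) ell := by
  refine (integrable_norm_sq hG).mono' ?_ (.of_forall fun t => ?_)
  · have hm : Measurable fun x : ℝ => if N < x then x ^ 2 else 0 :=
      Measurable.ite measurableSet_Ioi (by fun_prop) measurable_const
    exact (hm.comp_aemeasurable hG.1.norm.aemeasurable).aestronglyMeasurable
  · split_ifs
    · rw [Real.norm_of_nonneg (sq_nonneg _)]
    · rw [norm_zero]; positivity

lemma tendsto_tailSq {G : T → ℂ} (hG : MemLp G 2 ell) :
    Tendsto (tailSq G) atTop (𝓝 0) := by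
  have h := tendsto_integral_filter_of_dominated_convergence (μ := ell) (l := (atTop : Filter ℝ))
    (F := fun N t => if N < ‖G t‖ then ‖G t‖ ^ 2 else 0) (f := fun _ => 0)
    (fun t => ‖G t‖ ^ 2) (.of_forall fun N => (integrable_tailSq hG N).1)
    (.of_forall fun N => .of_forall fun t => ?_) (integrable_norm_sq hG)
    (.of_forall fun t => ?_)
  · rw [integral_zero] at h
    exact h
  · split_ifs
    · rw [Real.norm_of_nonneg (sq_nonneg _)]
    · rw [norm_zero]; positivity
  · refine tendsto_const_nhds.congr' ?_
    filter_upwards [eventually_ge_atTop ‖G t‖] with N hN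
    rw [if_neg (not_lt.2 hN)]

/-- Splitting at `‖G‖ = N` turns `L²`-smallness of a bounded `V` into that of `V G`, with `G` merely
square integrable. The explicit form yields the uniform rate in `dataGap`. -/
lemma integral_norm_mul_sq_le {V G : T → ℂ} {C : ℝ} (hV : AEStronglyMeasurable V ell)
    (hV2 : ∀ᵐ t ∂ell, ‖V t‖ ≤ C) (hG : MemLp G 2 ell) (N : ℝ) :
    ∫ t, ‖V t * G t‖ ^ 2 ∂ell ≤ N ^ 2 * ∫ t, ‖V t‖ ^ 2 ∂ell + C ^ 2 * tailSq G N := by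
  have hVL : MemLp V 2 ell := MemLp.of_bound hV C hV2
  have h1 := integrable_norm_sq hVL
  rw [tailSq, ← integral_const_mul, ← integral_const_mul,
    ← integral_add (h1.const_mul _) ((integrable_tailSq hG N).const_mul _)]
  refine integral_mono_ae (integrable_norm_sq (memLp_bdd_mul hV hV2 hG))
    ((h1.const_mul _).add ((integrable_tailSq hG N).const_mul _)) ?_
  filter_upwards [hV2] with t ht
  rw [norm_mul, mul_pow]
  have h2 : ‖V t‖ ^ 2 ≤ C ^ 2 := by gcongr
  split_ifs with h
  · nlinarith [mul_le_mul_of_nonneg_right h2 (sq_nonneg ‖G t‖),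
      mul_nonneg (sq_nonneg N) (sq_nonneg ‖V t‖)]
  · have h3 : ‖G t‖ ^ 2 ≤ N ^ 2 := by
      have := not_lt.1 h
      gcongr
    nlinarith [mul_le_mul_of_nonneg_left h3 (sq_nonneg ‖V t‖)]

lemma tendsto_integral_norm_mul_sq {V : ℕ → T → ℂ} {G : T → ℂ}
    (hV : ∀ n, AEStronglyMeasurable (V n) ell) (hV2 : ∀ n, ∀ᵐ t ∂ell, ‖V n t‖ ≤ 2)
    (hV0 : Tendsto (fun n => ∫ t, ‖V n t‖ ^ 2 ∂ell) atTop (𝓝 0)) (hG : MemLp G 2 ell) :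
    Tendsto (fun n => ∫ t, ‖V n t * G t‖ ^ 2 ∂ell) atTop (𝓝 0) := by
  rw [Metric.tendsto_nhds]
  intro ε hε
  obtain ⟨N, hN⟩ := ((tendsto_tailSq hG).eventually
    (gt_mem_nhds (show 0 < ε / 8 by positivity))).exists
  have h1 := (hV0.const_mul (N ^ 2))
  rw [mul_zero] at h1
  filter_upwards [h1.eventually (gt_mem_nhds (half_pos hε))] with n hn
  have h2 := integral_norm_mul_sq_le (hV n) (hV2 n) hG N
  have h3 : 0 ≤ ∫ t, ‖V n t * G t‖ ^ 2 ∂ell := integral_nonneg fun _ => sq_nonneg _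
  rw [Real.dist_eq, sub_zero, abs_of_nonneg h3]
  linarith

/-! ### Approximation by bounded outer functions: Smirnov's theorem and density -/

/-- The logarithm of the modulus of the outer functions approximating `1`. -/
def cutoff (φ : T → ℝ) (n : ℕ) (t : T) : ℝ := min (φ t) n - φ t

lemma cutoff_nonpos (φ : T → ℝ) (n : ℕ) (t : T) : cutoff φ n t ≤ 0 :=
  sub_nonpos.2 (min_le_left _ _)

lemma integrable_min_const {φ : T → ℝ} (hφ : Integrable φ ell) (n : ℕ) :
    Integrable (fun t => min (φ t) n) ell := hφ.inf (integrable_const _)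

lemma integrable_cutoff {φ : T → ℝ} (hφ : Integrable φ ell) (n : ℕ) :
    Integrable (cutoff φ n) ell := (integrable_min_const hφ n).sub hφ

lemma tendsto_integral_cutoff {φ : T → ℝ} (hφ : Integrable φ ell) :
    Tendsto (fun n => ∫ t, cutoff φ n t ∂ell) atTop (𝓝 0) := by
  have h := tendsto_integral_of_dominated_convergence (μ := ell) (F := cutoff φ)
    (f := fun _ => 0) (fun t => |φ t|) (fun n => (integrable_cutoff hφ n).1) hφ.abs
    (fun n => .of_forall fun t => ?_) (.of_forall fun t => ?_)
  · simpa using h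
  · have hn : (0 : ℝ) ≤ n := n.cast_nonneg
    rw [Real.norm_eq_abs, abs_of_nonpos (cutoff_nonpos φ n t), cutoff, neg_sub]
    rcases min_cases (φ t) (n : ℝ) with h | h
    · rw [h.1, sub_self]; positivity
    · rw [h.1]; linarith [le_abs_self (φ t)]
  · refine tendsto_const_nhds.congr' ?_
    obtain ⟨m, hm⟩ := exists_nat_ge (φ t)
    filter_upwards [eventually_ge_atTop m] with n hn
    have : φ t ≤ n := hm.trans (by exact_mod_cast hn)
    rw [cutoff, min_eq_left this, sub_self]

/-- The modulus is at most `1` and the mean value `exp (∫ cutoff)` tends to `1`; together these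
force `L²`-convergence to `1` without any pointwise information on arguments. -/
lemma tendsto_outerBdry_cutoff {φ : T → ℝ} (hφ : Integrable φ ell) :
    Tendsto (fun n => ∫ t, ‖outerBdry (cutoff φ n) t - 1‖ ^ 2 ∂ell) atTop (𝓝 0) := by
  have h1 : Tendsto (fun n => 2 - 2 * Real.exp (∫ t, cutoff φ n t ∂ell)) atTop (𝓝 0) := by
    have := ((Real.continuous_exp.tendsto 0).comp (tendsto_integral_cutoff hφ)).const_mul 2
    simpa using this.const_sub 2
  refine squeeze_zero (fun n => integral_nonneg fun _ => sq_nonneg _) (fun n => ?_) h1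
  have hi := integrable_cutoff hφ n
  rw [integral_norm_outerBdry_sub_one_sq hi (.of_forall (cutoff_nonpos φ n))]
  have h2 : ∫ t, Real.exp (2 * cutoff φ n t) ∂ell ≤ ∫ _, (1 : ℝ) ∂(ell : Measure T) := by
    refine integral_mono_of_nonneg (.of_forall fun _ => (Real.exp_pos _).le)
      (integrable_const _) (.of_forall fun t => ?_)
    exact Real.exp_le_one_iff.2 (by linarith [cutoff_nonpos φ n t])
  simp only [integral_const, probReal_univ, smul_eq_mul, mul_one] at h2
  linarith

lemma norm_outerBdry_le_one {φ : T → ℝ} (hφ : Integrable φ ell) (h0 : ∀ t, φ t ≤ 0) :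
    ∀ᵐ t ∂ell, ‖outerBdry φ t‖ ≤ 1 := by
  simpa using norm_outerBdry_le hφ (.of_forall h0)

lemma tendsto_outerBdry_cutoff_mul {φ : T → ℝ} (hφ : Integrable φ ell) {G : T → ℂ}
    (hG : MemLp G 2 ell) :
    Tendsto (fun n => ∫ t, ‖outerBdry (cutoff φ n) t * G t - G t‖ ^ 2 ∂ell) atTop (𝓝 0) := by
  simp_rw [← sub_one_mul]
  refine tendsto_integral_norm_mul_sq (fun n =>
    (aestronglyMeasurable_outerBdry (integrable_cutoff hφ n)).sub aestronglyMeasurable_const)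
    (fun n => ?_) (tendsto_outerBdry_cutoff hφ) hG
  filter_upwards [norm_outerBdry_le_one (integrable_cutoff hφ n) (cutoff_nonpos φ n)] with t ht
  refine (norm_sub_le _ _).trans ?_
  rw [norm_one]
  linarith

/-- **Smirnov's theorem**: if the product of an `H²`-function with an outer function is square
integrable on the circle, then it lies in `H²`. -/
theorem MemH2.outer_mul {φ : T → ℝ} (hφ : Integrable φ ell) {g : T → ℂ} (hg : MemH2 g)
    (hY : MemLp (fun t => outerBdry φ t * g t) 2 ell) :
    MemH2 (fun t => outerBdry φ t * g t) := by
  refine ⟨hY, fun k hk => ?_⟩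
  set Y : T → ℂ := fun t => outerBdry φ t * g t with hYdef
  have hc := fun n => integrable_cutoff hφ n
  -- The cutoff replaces the unbounded factor by the outer function of `min φ n`, a bounded
  -- multiplier of `g`.
  have hmem : ∀ n, MemH2 (fun t => outerBdry (cutoff φ n) t * Y t) := by
    intro n
    have hmin := integrable_min_const hφ n
    have hle : ∀ᵐ t ∂ell, min (φ t) (n : ℝ) ≤ n := .of_forall fun t => min_le_right _ _
    refine ((memH2_outerBdry hmin hle).bdd_mul (norm_outerBdry_le hmin hle) hg).congr ?_
    have h1 := outerBdry_add (hc n) hφ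
    simp only [cutoff, sub_add_cancel] at h1
    filter_upwards [h1] with t ht
    rw [ht, hYdef, mul_assoc]
  have hle : ∀ n, ‖fourierCoeff Y k‖ ^ 2 ≤
      ∫ t, ‖outerBdry (cutoff φ n) t * Y t - Y t‖ ^ 2 ∂ell := by
    intro n
    have h1 := norm_sq_fourierCoeff_le ((hmem n).1.sub hY) k
    have h2 := fourierCoeff_sub (hmem n).integrable (hY.integrable (by norm_num)) k
    rw [(hmem n).2 k hk, zero_sub] at h2
    simp only [Pi.sub_def] at h1
    rwa [h2, norm_neg] at h1
  have h0 := ge_of_tendsto' (tendsto_outerBdry_cutoff_mul hφ hY) hle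
  exact norm_eq_zero.1 (pow_eq_zero_iff two_ne_zero |>.1 (le_antisymm h0 (sq_nonneg _)))

/-- The multiples in `L²` of an outer function by `H²`-functions are dense in `H²`. -/
lemma MemH2.exists_tendsto_outer_mul {φ : T → ℝ} (hφ : Integrable φ ell) {G : T → ℂ}
    (hG : MemH2 G) :
    ∃ g : ℕ → T → ℂ, (∀ n, MemH2 (g n)) ∧
      (∀ n, MemLp (fun t => outerBdry φ t * g n t) 2 ell) ∧
      Tendsto (fun n => ∫ t, ‖outerBdry φ t * g n t - G t‖ ^ 2 ∂ell) atTop (𝓝 0) := by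
  have hneg : Integrable (fun t => -φ t) ell := hφ.neg
  have hmin := fun n => integrable_min_const hneg n
  have hle : ∀ n : ℕ, ∀ᵐ t ∂ell, min (-φ t) (n : ℝ) ≤ n :=
    fun n => .of_forall fun t => min_le_right _ _
  have heq : ∀ n : ℕ, (fun t => outerBdry φ t * (outerBdry (fun t => min (-φ t) n) t * G t)) =ᵐ[ell]
      fun t => outerBdry (cutoff (fun t => -φ t) n) t * G t := by
    intro n
    have h1 := outerBdry_add hφ (hmin n)
    have h2 : (fun t => φ t + min (-φ t) n) = cutoff (fun t => -φ t) n := by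
      ext t
      rw [cutoff]
      ring
    rw [h2] at h1
    filter_upwards [h1] with t ht
    rw [ht, mul_assoc]
  -- A truncated version of `G / w`, so that multiplying back by `w` gives `G` times an outer
  -- function close to `1`.
  refine ⟨fun n t => outerBdry (fun t => min (-φ t) n) t * G t,
    fun n => (memH2_outerBdry (hmin n) (hle n)).bdd_mul (norm_outerBdry_le (hmin n) (hle n)) hG,
    fun n => (MemLp.ae_eq (heq n).symm ?_), ?_⟩
  · have hc := integrable_cutoff hneg n
    exact memLp_bdd_mul (aestronglyMeasurable_outerBdry hc)
      (norm_outerBdry_le_one hc (cutoff_nonpos _ n)) hG.1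
  · refine (tendsto_outerBdry_cutoff_mul hneg hG.1).congr fun n => integral_congr_ae ?_
    filter_upwards [heq n] with t ht
    rw [ht]

/-! ### The projection onto the Hardy space -/

/-- `G` is the orthogonal projection of `F` onto the Hardy space. -/
def IsHardyProj (F G : T → ℂ) : Prop :=
  MemH2 G ∧ ∀ n : ℕ, fourierCoeff G n = fourierCoeff F n

lemma exists_isHardyProj {F : T → ℂ} (hF : MemLp F 2 ell) : ∃ G, IsHardyProj F G := by
  refine exists_memH2_fourierCoeff (a := fun n : ℕ => fourierCoeff F n) ?_
  exact (hasSum_sq_fourierCoeff_memLp hF).summable.comp_injective Nat.cast_injective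

lemma IsHardyProj.integral_sq_le {F G : T → ℂ} (h : IsHardyProj F G) (hF : MemLp F 2 ell) :
    ∫ t, ‖G t‖ ^ 2 ∂ell ≤ ∫ t, ‖F t‖ ^ 2 ∂ell := by
  refine integral_sq_le_of_fourierCoeff_le h.1.1 hF fun n => ?_
  rcases lt_or_ge n 0 with hn | hn
  · rw [h.1.2 n hn, norm_zero]; positivity
  · lift n to ℕ using hn
    rw [h.2]

lemma IsHardyProj.integral_sub_sq_le {F G F' G' : T → ℂ} (h : IsHardyProj F G)
    (h' : IsHardyProj F' G') (hF : MemLp F 2 ell) (hF' : MemLp F' 2 ell) :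
    ∫ t, ‖G t - G' t‖ ^ 2 ∂ell ≤ ∫ t, ‖F t - F' t‖ ^ 2 ∂ell := by
  refine integral_sq_le_of_fourierCoeff_le (X := fun t => G t - G' t) (Y := fun t => F t - F' t)
    (h.1.1.sub h'.1.1) (hF.sub hF') fun n => ?_
  rw [fourierCoeff_sub h.1.integrable h'.1.integrable,
    fourierCoeff_sub (hF.integrable (by norm_num)) (hF'.integrable (by norm_num))]
  rcases lt_or_ge n 0 with hn | hn
  · rw [h.1.2 n hn, h'.1.2 n hn, sub_zero, norm_zero]; positivity
  · lift n to ℕ using hn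
    rw [h.2, h'.2]

/-- Pythagoras read on coefficients: `F - G` lives on negative indices, `Y - G` on the others. -/
lemma IsHardyProj.integral_sub_sq_eq {F G Y : T → ℂ} (h : IsHardyProj F G) (hF : MemLp F 2 ell)
    (hY : MemH2 Y) :
    ∫ t, ‖F t - Y t‖ ^ 2 ∂ell = ∫ t, ‖F t - G t‖ ^ 2 ∂ell + ∫ t, ‖Y t - G t‖ ^ 2 ∂ell := by
  have h1 := hasSum_sq_fourierCoeff_memLp (X := fun t => F t - Y t) (hF.sub hY.1)
  have h2 := hasSum_sq_fourierCoeff_memLp (X := fun t => F t - G t) (hF.sub h.1.1)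
  have h3 := hasSum_sq_fourierCoeff_memLp (X := fun t => Y t - G t) (hY.1.sub h.1.1)
  have hFi := hF.integrable (q := 2) (by norm_num)
  simp_rw [fourierCoeff_sub hFi hY.integrable] at h1
  simp_rw [fourierCoeff_sub hFi h.1.integrable] at h2
  simp_rw [fourierCoeff_sub hY.integrable h.1.integrable] at h3
  refine h1.unique ?_
  have h4 := h2.add h3
  convert h4 using 2 with n
  rcases lt_or_ge n 0 with hn | hn
  · rw [h.1.2 n hn, hY.2 n hn]
    simp
  · lift n to ℕ using hn
    rw [h.2, sub_self, norm_sub_rev (fourierCoeff F n)]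
    simp

lemma IsHardyProj.dist_le {F G Y : T → ℂ} (h : IsHardyProj F G) (hF : MemLp F 2 ell)
    (hY : MemH2 Y) : ∫ t, ‖F t - G t‖ ^ 2 ∂ell ≤ ∫ t, ‖F t - Y t‖ ^ 2 ∂ell := by
  rw [h.integral_sub_sq_eq hF hY]
  exact le_add_of_nonneg_right (integral_nonneg fun _ => sq_nonneg _)

/-- The Cauchy integral sees only coefficients of nonnegative index, which `F` and `G` share. -/
lemma IsHardyProj.cauchyInt_eq {F G : T → ℂ} (h : IsHardyProj F G) (hF : MemLp F 2 ell) {z : ℂ}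
    (hz : ‖z‖ < 1) : cauchyInt F z = poissonInt G z := by
  rw [h.1.poissonInt_eq hz]
  have h1 := hasSum_cauchyInt h.1.integrable hz
  simp_rw [h.2] at h1
  exact (hasSum_cauchyInt (hF.integrable (by norm_num)) hz).unique h1

/-! ### The dual functional as a distance to the Hardy space -/

lemma nullMeasurableSet_of_frontier {I : Set T} (h : ell (frontier I) = 0) :
    NullMeasurableSet I ell := by
  have h1 : interior I =ᵐ[ell] I := by
    refine (ae_le_set.2 ?_).antisymm (ae_le_set.2 ?_)
    · rw [Set.sdiff_eq_empty.2 interior_subset, measure_empty]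
    · exact measure_mono_null (Set.sdiff_subset_sdiff_left subset_closure) h
  exact isOpen_interior.measurableSet.nullMeasurableSet.congr h1

lemma integrable_of_restrict {E : Type*} [NormedAddCommGroup E] {I : Set T} {X : T → E}
    (h1 : IntegrableOn X I ell) (h2 : IntegrableOn X Iᶜ ell) : Integrable X ell := by
  rw [← integrableOn_univ, ← Set.union_compl_self I]
  exact h1.union h2

lemma memLp_two_of_restrict {I : Set T} {X : T → ℂ} (h1 : MemLp X 2 (ell.restrict I))
    (h2 : MemLp X 2 (ell.restrict Iᶜ)) : MemLp X 2 ell := by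
  have hm : AEStronglyMeasurable X ell := by
    rw [← Measure.restrict_univ (μ := ell), ← Set.union_compl_self I]
    exact aestronglyMeasurable_union_iff.2 ⟨h1.1, h2.1⟩
  rw [memLp_two_iff_integrable_sq_norm hm]
  exact integrable_of_restrict (integrable_norm_sq h1) (integrable_norm_sq h2)

lemma concat_of_mem {E : Type*} {I : Set T} (a b : T → E) {t : T} (ht : t ∈ I) :
    concat I a b t = a t := if_pos ht

lemma concat_of_notMem {E : Type*} {I : Set T} (a b : T → E) {t : T} (ht : t ∉ I) :
    concat I a b t = b t := if_neg ht

lemma concat_ae_eq_left {E : Type*} {I : Set T} (hI : NullMeasurableSet I ell) (a b : T → E) :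
    concat I a b =ᵐ[ell.restrict I] a := by
  filter_upwards [ae_restrict_mem₀ hI] with t ht using concat_of_mem a b ht

lemma concat_ae_eq_right {E : Type*} {I : Set T} (hI : NullMeasurableSet I ell) (a b : T → E) :
    concat I a b =ᵐ[ell.restrict Iᶜ] b := by
  filter_upwards [ae_restrict_mem₀ hI.compl] with t ht using concat_of_notMem a b ht

/-- The logarithm of the modulus of `w_{ν^{1/2}}`. -/
def logModulus (I : Set T) (ν : T → ℝ) (t : T) : ℝ :=
  Real.log (concat I (fun _ => 1) (fun θ => Real.sqrt (ν θ)) t)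

lemma boundaryValue_outerSqrt (I : Set T) (ν : T → ℝ) :
    boundaryValue (outerSqrt I ν) = outerBdry (logModulus I ν) := rfl

lemma logModulus_of_mem {I : Set T} (ν : T → ℝ) {t : T} (ht : t ∈ I) : logModulus I ν t = 0 := by
  rw [logModulus, concat_of_mem _ _ ht, Real.log_one]

lemma two_mul_logModulus_of_notMem {I : Set T} {ν : T → ℝ} {t : T} (ht : t ∉ I) (h0 : 0 ≤ ν t) :
    2 * logModulus I ν t = Real.log (ν t) := by
  rw [logModulus, concat_of_notMem _ _ ht, Real.log_sqrt h0]
  ring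

lemma integrable_logModulus {I : Set T} (hI : NullMeasurableSet I ell) {ν : T → ℝ}
    (hν : LogIntegrableOn ν Iᶜ) : Integrable (logModulus I ν) ell := by
  refine integrable_of_restrict (I := I) ((integrable_const (0 : ℝ)).congr ?_)
    ((hν.2.div_const 2).congr ?_)
  · filter_upwards [ae_restrict_mem₀ hI] with t ht
    rw [logModulus_of_mem ν ht]
  · filter_upwards [ae_restrict_mem₀ hI.compl, hν.1] with t ht h0
    rw [← two_mul_logModulus_of_notMem ht h0.le]
    ring

lemma norm_outerBdry_logModulus_left {I : Set T} (hI : NullMeasurableSet I ell) {ν : T → ℝ}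
    (hν : LogIntegrableOn ν Iᶜ) :
    ∀ᵐ t ∂(ell.restrict I), ‖outerBdry (logModulus I ν) t‖ = 1 := by
  filter_upwards [ae_restrict_of_ae (norm_outerBdry (integrable_logModulus hI hν)),
    ae_restrict_mem₀ hI] with t h1 ht
  rw [h1, logModulus_of_mem ν ht, Real.exp_zero]

lemma norm_outerBdry_logModulus_right {I : Set T} (hI : NullMeasurableSet I ell) {ν : T → ℝ}
    (hν : LogIntegrableOn ν Iᶜ) :
    ∀ᵐ t ∂(ell.restrict Iᶜ), ‖outerBdry (logModulus I ν) t‖ ^ 2 = ν t := by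
  filter_upwards [ae_restrict_of_ae (norm_outerBdry (integrable_logModulus hI hν)),
    ae_restrict_mem₀ hI.compl, hν.1] with t h1 ht h0
  rw [h1, ← Real.exp_nat_mul, Nat.cast_ofNat, two_mul_logModulus_of_notMem ht h0.le,
    Real.exp_log h0]

/-- The function `w_{ν^{1/2}} f ∨ 0`. -/
def datum (I : Set T) (f : T → ℂ) (ν : T → ℝ) : T → ℂ :=
  concat I (fun t => outerBdry (logModulus I ν) t * f t) (fun _ => 0)

section datum

variable {I : Set T} {f : T → ℂ} {ν : T → ℝ}

lemma memLp_datum (hI : NullMeasurableSet I ell) (hf : MemLp f 2 (ell.restrict I))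
    (hν : LogIntegrableOn ν Iᶜ) : MemLp (datum I f ν) 2 ell := by
  have hW := (aestronglyMeasurable_outerBdry (integrable_logModulus hI hν)).restrict (s := I)
  refine memLp_two_of_restrict (I := I) ?_ ?_
  · refine MemLp.ae_eq (concat_ae_eq_left hI _ _).symm (hf.of_le (hW.mul hf.1) ?_)
    filter_upwards [norm_outerBdry_logModulus_left hI hν] with t ht
    rw [norm_mul, ht, one_mul]
  · exact MemLp.ae_eq (concat_ae_eq_right hI _ _).symm MemLp.zero

/-- Since `|w| = 1` on `I`, `|w|² = ν` on `J` and the datum vanishes on `J`, the two quadratic terms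
merge into one `L²`-distance. -/
lemma lagrangian_eq (hI : NullMeasurableSet I ell) (hf : MemLp f 2 (ell.restrict I))
    (hν : LogIntegrableOn ν Iᶜ) {M : T → ℝ} (hM : MemL1Weighted M Iᶜ ν) {g : T → ℂ}
    (hg : IntegrableOn (fun θ => ν θ * ‖g θ‖ ^ 2) Iᶜ ell)
    (hWg : MemLp (fun t => outerBdry (logModulus I ν) t * g t) 2 ell) :
    lagrangian I f M ν g =
      ∫ t, ‖datum I f ν t - outerBdry (logModulus I ν) t * g t‖ ^ 2 ∂ell -
        ∫ t in Iᶜ, ν t * M t ^ 2 ∂ell := by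
  have h1 := integrable_norm_sq ((memLp_datum hI hf hν).sub hWg)
  simp only [Pi.sub_apply] at h1
  rw [← integral_add_compl₀ hI h1, lagrangian]
  simp_rw [mul_sub]
  rw [integral_sub hg hM, ← add_sub_assoc]
  congr 2
  · refine integral_congr_ae ?_
    filter_upwards [norm_outerBdry_logModulus_left hI hν, ae_restrict_mem₀ hI] with t h2 ht
    rw [datum, concat_of_mem _ _ ht, ← mul_sub, norm_mul, h2, one_mul]
  · refine integral_congr_ae ?_
    filter_upwards [norm_outerBdry_logModulus_right hI hν, ae_restrict_mem₀ hI.compl] with t h2 ht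
    rw [datum, concat_of_notMem _ _ ht, zero_sub, norm_neg, norm_mul, mul_pow, h2]

lemma memLp_outerBdry_mul (hI : NullMeasurableSet I ell) (hν : LogIntegrableOn ν Iᶜ) {g : T → ℂ}
    (hg : MemLp g 2 ell) (hint : IntegrableOn (fun θ => ν θ * ‖g θ‖ ^ 2) Iᶜ ell) :
    MemLp (fun t => outerBdry (logModulus I ν) t * g t) 2 ell := by
  have hm : AEStronglyMeasurable (fun t => outerBdry (logModulus I ν) t * g t) ell :=
    (aestronglyMeasurable_outerBdry (integrable_logModulus hI hν)).mul hg.1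
  rw [memLp_two_iff_integrable_sq_norm hm]
  refine integrable_of_restrict (I := I) ((integrable_norm_sq (hg.restrict I)).congr ?_)
    (hint.congr ?_)
  · filter_upwards [norm_outerBdry_logModulus_left hI hν] with t ht
    rw [norm_mul, ht, one_mul]
  · filter_upwards [norm_outerBdry_logModulus_right hI hν] with t ht
    rw [norm_mul, mul_pow, ht]

/-- The dual functional is the squared distance to the Hardy space of `w_{ν^{1/2}} f ∨ 0`, up to a
linear term. -/
theorem dualFunctional_eq (hI : NullMeasurableSet I ell) (hf : MemLp f 2 (ell.restrict I))
    (hν : LogIntegrableOn ν Iᶜ) {M : T → ℝ} (hM : MemL1Weighted M Iᶜ ν) {G : T → ℂ}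
    (hG : IsHardyProj (datum I f ν) G) :
    dualFunctional I f M ν =
      ∫ t, ‖datum I f ν t - G t‖ ^ 2 ∂ell - ∫ t in Iᶜ, ν t * M t ^ 2 ∂ell := by
  have hφ := integrable_logModulus hI hν
  have hF := memLp_datum hI hf hν
  have hlow : ∀ v ∈ {v : ℝ | ∃ g : T → ℂ, MemH2 g ∧
      IntegrableOn (fun θ => ν θ * ‖g θ‖ ^ 2) Iᶜ ell ∧ v = lagrangian I f M ν g},
      ∫ t, ‖datum I f ν t - G t‖ ^ 2 ∂ell - ∫ t in Iᶜ, ν t * M t ^ 2 ∂ell ≤ v := by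
    rintro v ⟨g, hg, hint, rfl⟩
    have hWg := memLp_outerBdry_mul hI hν hg.1 hint
    rw [lagrangian_eq hI hf hν hM hint hWg]
    exact sub_le_sub_right (hG.dist_le hF (hg.outer_mul hφ hWg)) _
  -- The natural minimizer `G / w` is not known to lie in `H²`, so the infimum is approached along a
  -- sequence.
  obtain ⟨g, hg, hWg, hlim⟩ := hG.1.exists_tendsto_outer_mul hφ
  have hint : ∀ n, IntegrableOn (fun θ => ν θ * ‖g n θ‖ ^ 2) Iᶜ ell := fun n => by
    refine (integrable_norm_sq ((hWg n).restrict Iᶜ)).congr ?_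
    filter_upwards [norm_outerBdry_logModulus_right hI hν] with t ht
    rw [norm_mul, mul_pow, ht]
  refine le_antisymm ?_ (le_csInf ⟨_, g 0, hg 0, hint 0, rfl⟩ hlow)
  have hlim2 := (hlim.const_add (∫ t, ‖datum I f ν t - G t‖ ^ 2 ∂ell)).sub_const
    (∫ t in Iᶜ, ν t * M t ^ 2 ∂ell)
  rw [add_zero] at hlim2
  refine ge_of_tendsto' hlim2 fun n => ?_
  rw [← hG.integral_sub_sq_eq hF ((hg n).outer_mul hφ (hWg n)),
    ← lagrangian_eq hI hf hν hM (hint n) (hWg n)]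
  exact csInf_le ⟨_, hlow⟩ ⟨g n, hg n, hint n, rfl⟩

/-- The factor `2πi` cancels against `dξ = 2πi ξ dℓ`, and `ξ / (ξ - z)` is the Cauchy kernel. -/
lemma carleman_eq (hI : NullMeasurableSet I ell) {z : ℂ} (hz : ‖z‖ < 1) :
    carleman I f ν z = cauchyInt (datum I f ν) z / outerExp (logModulus I ν) z := by
  have h0 : (2 * π * Complex.I : ℂ) ≠ 0 := by simp [Real.pi_ne_zero]
  have h1 : ∫ θ in I, boundaryValue (outerSqrt I ν) θ * f θ / (expI θ - z) *
      (Complex.I * expI θ) = 2 * π * Complex.I * cauchyInt (datum I f ν) z := by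
    have h2 : cauchyInt (datum I f ν) z =
        ∫ t in I, (1 - z / expI t)⁻¹ * datum I f ν t ∂ell := by
      refine (setIntegral_eq_integral_of_forall_compl_eq_zero fun t ht => ?_).symm
      rw [datum, concat_of_notMem _ _ ht, mul_zero]
    have h3 : ∀ t ∈ I, boundaryValue (outerSqrt I ν) t * f t / (expI t - z) *
        (Complex.I * expI t) = Complex.I * ((1 - z / expI t)⁻¹ * datum I f ν t) := by
      intro t ht
      rw [datum, concat_of_mem _ _ ht, boundaryValue_outerSqrt]
      have h4 := expI_ne_zero t
      have h5 := expI_sub_ne_zero hz t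
      have h6 : (1 - z / expI t)⁻¹ = expI t / (expI t - z) := by
        rw [one_sub_div h4, inv_div]
      rw [h6]
      ring
    rw [volume_eq_smul_ell, Measure.restrict_smul, integral_smul_measure,
      ENNReal.toReal_ofReal Real.two_pi_pos.le, h2, integral_congr_ae
        ((ae_restrict_mem₀ hI).mono h3), integral_const_mul, Complex.real_smul]
    push_cast
    ring
  rw [carleman, h1, mul_inv, mul_comm, ← mul_assoc, mul_comm]
  rw [show outerSqrt I ν z = outerExp (logModulus I ν) z from rfl]
  field_simp

/-- The boundary function of `g_ν`. -/
theorem ae_hasNontangentialLimit_carleman (hI : NullMeasurableSet I ell)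
    (hf : MemLp f 2 (ell.restrict I)) (hν : LogIntegrableOn ν Iᶜ) {G : T → ℂ}
    (hG : IsHardyProj (datum I f ν) G) :
    ∀ᵐ θ ∂ell, HasNontangentialLimit (carleman I f ν) θ
      (G θ / outerBdry (logModulus I ν) θ) := by
  have hφ := integrable_logModulus hI hν
  filter_upwards [ae_hasNontangentialLimit_poissonInt hG.1.integrable,
    ae_hasNontangentialLimit_outerExp hφ, norm_outerBdry hφ] with θ h1 h2 h3
  have hne : outerBdry (logModulus I ν) θ ≠ 0 :=
    norm_ne_zero_iff.1 (by rw [h3]; exact (Real.exp_pos _).ne')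
  refine (h1.div h2 hne).congr fun z hz => ?_
  rw [carleman_eq hI hz, hG.cauchyInt_eq (memLp_datum hI hf hν) hz]

end datum

/-! ### Perturbation of the weight -/

lemma outerBdry_zero : outerBdry (fun _ => 0) =ᵐ[ell] fun _ => 1 := by
  refine outerBdry_eq_of_limit (.of_forall fun θ α _ => ?_)
  have h : outerExp (fun _ => 0) = fun _ => 1 := by
    ext z
    simp [outerExp]
  rw [h]
  exact tendsto_const_nhds

lemma abs_log_one_add_le {r t : ℝ} (ht1 : t < 1) (hr : |r| ≤ t) :
    |Real.log (1 + r)| ≤ -Real.log (1 - t) := by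
  obtain ⟨h1, h2⟩ := abs_le.1 hr
  rw [abs_le, neg_neg, ← Real.log_inv]
  refine ⟨Real.log_le_log (by linarith) (by linarith), Real.log_le_log (by linarith) ?_⟩
  rw [le_inv_comm₀ (by linarith) (by linarith), ← one_div, le_div_iff₀ (by linarith)]
  nlinarith

/-- Stability of the weights under relatively small perturbations. -/
lemma LogIntegrableOn.add {S : Set T} {μ h : T → ℝ} {t : ℝ} (hμ : LogIntegrableOn μ S)
    (hr : AEStronglyMeasurable (fun θ => h θ / μ θ) (ell.restrict S)) (ht1 : t < 1)
    (hrt : ∀ᵐ θ ∂(ell.restrict S), |h θ / μ θ| ≤ t) :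
    LogIntegrableOn (fun θ => μ θ + h θ) S := by
  have hmul : ∀ᵐ θ ∂(ell.restrict S), μ θ + h θ = μ θ * (1 + h θ / μ θ) ∧ 0 < 1 + h θ / μ θ := by
    filter_upwards [hμ.1, hrt] with θ h0 h1
    refine ⟨by field_simp, by linarith [(abs_le.1 h1).1]⟩
  refine ⟨?_, ?_⟩
  · filter_upwards [hμ.1, hmul] with θ h0 h1
    rw [h1.1]
    exact mul_pos h0 h1.2
  · have h2 : IntegrableOn (fun θ => Real.log (1 + h θ / μ θ)) S ell := by
      refine Integrable.of_bound (C := -Real.log (1 - t)) ?_ ?_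
      · exact (Real.measurable_log.comp_aemeasurable
          (hr.aemeasurable.const_add 1)).aestronglyMeasurable
      · filter_upwards [hrt] with θ h1 using abs_log_one_add_le ht1 h1
    refine (hμ.2.add h2).congr ?_
    filter_upwards [hμ.1, hmul] with θ h0 h1
    rw [h1.1, Real.log_mul h0.ne' h1.2.ne']
    rfl

/-- The outer multiplier taking the datum for a weight to the datum for a perturbed weight. -/
lemma exists_multiplier {I : Set T} (hI : NullMeasurableSet I ell) {μ h : T → ℝ} {t : ℝ}
    (hμ : LogIntegrableOn μ Iᶜ)
    (hr : AEStronglyMeasurable (fun θ => h θ / μ θ) (ell.restrict Iᶜ)) (ht0 : 0 ≤ t) (ht1 : t < 1)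
    (hrt : ∀ᵐ θ ∂(ell.restrict Iᶜ), |h θ / μ θ| ≤ t) (f : T → ℂ) :
    ∃ D E : T → ℂ, MemH2 D ∧ MemH2 E ∧
      (∀ᵐ θ ∂ell, ‖D θ‖ ^ 2 = 1 + concat I (fun _ => 0) (fun θ => h θ / μ θ) θ) ∧
      (∀ᵐ θ ∂ell, E θ * D θ = 1) ∧
      ∫ θ, ‖D θ - 1‖ ^ 2 ∂ell ≤ 3 * t ∧
      ∀ᵐ θ ∂ell, datum I f (fun θ => μ θ + h θ) θ = D θ * datum I f μ θ := by
  have hν := hμ.add hr ht1 hrt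
  set ν : T → ℝ := fun θ => μ θ + h θ with hν_def
  set R : T → ℝ := concat I (fun _ => 0) (fun θ => h θ / μ θ) with hR_def
  have hφμ := integrable_logModulus hI hμ
  have hφν := integrable_logModulus hI hν
  -- `k` is half the logarithm of `1 + R`. It is bounded on both sides, so the outer functions of
  -- `k` and `-k` are bounded and mutually inverse.
  set k : T → ℝ := fun θ => logModulus I ν θ - logModulus I μ θ with hk_def
  have hk : Integrable k ell := hφν.sub hφμ
  have hkn : Integrable (fun θ => -k θ) ell := hk.neg
  have hR : ∀ᵐ θ ∂ell, |R θ| ≤ t := by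
    refine ae_of_ae_restrict_of_ae_restrict_compl I ?_ ?_
    · filter_upwards [ae_restrict_mem₀ hI] with θ hθ
      rw [hR_def, concat_of_mem _ _ hθ, abs_zero]
      exact ht0
    · filter_upwards [ae_restrict_mem₀ hI.compl, hrt] with θ hθ h1
      rwa [hR_def, concat_of_notMem _ _ hθ]
  have hexp : ∀ᵐ θ ∂ell, Real.exp (2 * k θ) = 1 + R θ := by
    refine ae_of_ae_restrict_of_ae_restrict_compl I ?_ ?_
    · filter_upwards [ae_restrict_mem₀ hI] with θ hθ
      rw [hR_def, concat_of_mem _ _ hθ, hk_def]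
      simp only [logModulus_of_mem _ hθ, sub_zero, mul_zero, Real.exp_zero, add_zero]
    · filter_upwards [ae_restrict_mem₀ hI.compl, hμ.1, hν.1] with θ hθ h1 h2
      rw [hR_def, concat_of_notMem _ _ hθ, hk_def]
      simp only [mul_sub]
      rw [two_mul_logModulus_of_notMem hθ h1.le, two_mul_logModulus_of_notMem hθ h2.le,
        Real.exp_sub, Real.exp_log h1, Real.exp_log h2, hν_def]
      field_simp
  have hkup : ∀ᵐ θ ∂ell, k θ ≤ t := by
    filter_upwards [hexp, hR] with θ h1 h2
    have h3 := Real.add_one_le_exp (2 * k θ)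
    have h4 := (abs_le.1 h2).2
    linarith
  have hlog : Real.log (1 - t) ≤ 0 := Real.log_nonpos (by linarith) (by linarith)
  have hklow : ∀ᵐ θ ∂ell, Real.log (1 - t) ≤ k θ := by
    filter_upwards [hexp, hR] with θ h1 h2
    have h3 : Real.log (1 - t) ≤ 2 * k θ := by
      rw [Real.log_le_iff_le_exp (by linarith), h1]
      linarith [(abs_le.1 h2).1]
    linarith
  have hkup' : ∀ᵐ θ ∂ell, -k θ ≤ -Real.log (1 - t) := hklow.mono fun θ h => neg_le_neg h
  have hnorm := norm_outerBdry hk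
  refine ⟨outerBdry k, outerBdry fun θ => -k θ, memH2_outerBdry hk hkup,
    memH2_outerBdry hkn hkup', ?_, ?_, ?_, ?_⟩
  · filter_upwards [hexp, hnorm] with θ h1 h2
    rw [h2, ← Real.exp_nat_mul, Nat.cast_ofNat, h1]
  · have h1 := outerBdry_add hkn hk
    simp only [neg_add_cancel] at h1
    filter_upwards [h1, outerBdry_zero] with θ h2 h3
    rw [← h2, h3]
  -- Here `3 t = (1 + t) - 2 (1 - t) + 1`, from `exp (2k) ≤ 1 + t` and `exp (∫ k) ≥ 1 - t`.
  · rw [integral_norm_outerBdry_sub_one_sq hk hkup]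
    have h1 : ∫ θ, Real.exp (2 * k θ) ∂ell ≤ ∫ _, (1 + t) ∂(ell : Measure T) := by
      refine integral_mono_of_nonneg (.of_forall fun _ => (Real.exp_pos _).le)
        (integrable_const _) ?_
      filter_upwards [hexp, hR] with θ h1 h2
      rw [h1]
      linarith [(abs_le.1 h2).2]
    have h2 : ∫ _, Real.log (1 - t) ∂(ell : Measure T) ≤ ∫ θ, k θ ∂ell :=
      integral_mono_ae (integrable_const _) hk hklow
    simp only [integral_const, probReal_univ, smul_eq_mul, one_mul] at h1 h2
    have h3 := Real.exp_le_exp.2 h2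
    rw [Real.exp_log (by linarith)] at h3
    linarith
  · have h1 := outerBdry_add hk hφμ
    simp only [hk_def, sub_add_cancel] at h1
    filter_upwards [h1] with θ h2
    by_cases hθ : θ ∈ I
    · rw [datum, datum, concat_of_mem _ _ hθ, concat_of_mem _ _ hθ, ← mul_assoc, ← h2]
    · rw [datum, datum, concat_of_notMem _ _ hθ, concat_of_notMem _ _ hθ, mul_zero]

lemma integrable_mul_of_abs_le {R X : T → ℝ} {t : ℝ} (hRm : AEStronglyMeasurable R ell)
    (hR : ∀ᵐ θ ∂ell, |R θ| ≤ t) (hX : Integrable X ell) :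
    Integrable (fun θ => R θ * X θ) ell := hX.bdd_mul hRm hR

/-- First-order expansion of the squared distance to the Hardy space. -/
lemma abs_distSq_sub_le {F F' G G' D E : T → ℂ} {R : T → ℝ} {t A B η : ℝ}
    (hF : MemLp F 2 ell) (hF' : MemLp F' 2 ell)
    (hG : IsHardyProj F G) (hG' : IsHardyProj F' G') (hD : MemH2 D) (hE : MemH2 E)
    (ht0 : 0 ≤ t) (ht1 : t < 1) (hRm : AEStronglyMeasurable R ell) (hR : ∀ᵐ θ ∂ell, |R θ| ≤ t)
    (hDR : ∀ᵐ θ ∂ell, ‖D θ‖ ^ 2 = 1 + R θ) (hED : ∀ᵐ θ ∂ell, E θ * D θ = 1)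
    (hFF' : ∀ᵐ θ ∂ell, F' θ = D θ * F θ) (hRF : ∀ θ, R θ ≠ 0 → F θ = 0)
    (hA : ∫ θ, ‖F θ‖ ^ 2 ∂ell ≤ A) (hA' : ∫ θ, ‖F' θ‖ ^ 2 ∂ell ≤ A)
    (hB : ∫ θ, ‖F θ - F' θ‖ ^ 2 ∂ell ≤ B) (hη : 0 < η) :
    |∫ θ, ‖F' θ - G' θ‖ ^ 2 ∂ell - ∫ θ, ‖F θ - G θ‖ ^ 2 ∂ell - ∫ θ, R θ * ‖G θ‖ ^ 2 ∂ell| ≤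
      t * (B / (2 * η) + 2 * η * A + t / (1 - t) * A) := by
  have hR1 : ∀ᵐ θ ∂ell, 0 < 1 + R θ := by
    filter_upwards [hR] with θ h1
    linarith [(abs_le.1 h1).1]
  have hER : ∀ᵐ θ ∂ell, ‖E θ‖ ^ 2 = (1 + R θ)⁻¹ := by
    filter_upwards [hDR, hED] with θ h1 h2
    refine eq_inv_of_mul_eq_one_left ?_
    rw [← h1, ← mul_pow, ← norm_mul, h2, norm_one, one_pow]
  have hDb : ∀ᵐ θ ∂ell, ‖D θ‖ ≤ 2 := by
    filter_upwards [hDR, hR] with θ h1 h2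
    nlinarith [(abs_le.1 h2).2, norm_nonneg (D θ)]
  have hEb : ∀ᵐ θ ∂ell, ‖E θ‖ ≤ 1 + (1 - t)⁻¹ := by
    filter_upwards [hER, hR] with θ h1 h2
    have h3 : (1 + R θ)⁻¹ ≤ (1 - t)⁻¹ :=
      inv_anti₀ (by linarith) (by linarith [(abs_le.1 h2).1])
    nlinarith [sq_nonneg (‖E θ‖ - 1), norm_nonneg (E θ)]
  have hGi := integrable_norm_sq hG.1.1
  have hGi' := integrable_norm_sq hG'.1.1
  have hFG : Integrable (fun θ => ‖F θ - G θ‖ ^ 2) ell := integrable_norm_sq (hF.sub hG.1.1)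
  have hFG' : Integrable (fun θ => ‖F' θ - G' θ‖ ^ 2) ell := integrable_norm_sq (hF'.sub hG'.1.1)
  have hGG' : Integrable (fun θ => ‖G θ - G' θ‖ ^ 2) ell := integrable_norm_sq (hG.1.1.sub hG'.1.1)
  have hRG := integrable_mul_of_abs_le hRm hR hGi
  set Q : T → ℝ := fun θ => R θ / (1 + R θ) with hQ_def
  have hQm : AEStronglyMeasurable Q ell :=
    (hRm.aemeasurable.div (hRm.aemeasurable.const_add 1)).aestronglyMeasurable
  have hQ : ∀ᵐ θ ∂ell, |Q θ| ≤ t / (1 - t) := by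
    filter_upwards [hR, hR1] with θ h1 h2
    rw [hQ_def, abs_div, abs_of_pos h2]
    have := (abs_le.1 h1).1
    gcongr
    linarith
  have hQG := integrable_mul_of_abs_le hQm hQ hGi'
  -- Trial function `D G`: where `R ≠ 0` the datum `F` vanishes, so `|D|² |F - G|² = |F - G|² + R
  -- |G|²`.
  have hup : ∫ θ, ‖F' θ - G' θ‖ ^ 2 ∂ell ≤
      ∫ θ, ‖F θ - G θ‖ ^ 2 ∂ell + ∫ θ, R θ * ‖G θ‖ ^ 2 ∂ell := by
    refine (hG'.dist_le hF' (hD.bdd_mul hDb hG.1)).trans_eq ?_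
    rw [← integral_add hFG hRG]
    refine integral_congr_ae ?_
    filter_upwards [hFF', hDR] with θ h1 h2
    rw [h1, ← mul_sub, norm_mul, mul_pow, h2]
    by_cases h0 : R θ = 0
    · rw [h0]; ring
    · rw [hRF θ h0, zero_sub, norm_neg]; ring
  -- Trial function `E G'`, the reverse perturbation, with `|E|² = 1 - Q`.
  have hlow : ∫ θ, ‖F θ - G θ‖ ^ 2 ∂ell ≤
      ∫ θ, ‖F' θ - G' θ‖ ^ 2 ∂ell - ∫ θ, Q θ * ‖G' θ‖ ^ 2 ∂ell := by
    refine (hG.dist_le hF (hE.bdd_mul hEb hG'.1)).trans_eq ?_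
    rw [← integral_sub hFG' hQG]
    refine integral_congr_ae ?_
    filter_upwards [hFF', hER, hED, hR1] with θ h1 h2 h3 h4
    have h5 : F θ - E θ * G' θ = E θ * (F' θ - G' θ) := by
      rw [h1, mul_sub, ← mul_assoc, h3, one_mul]
    rw [h5, norm_mul, mul_pow, h2, hQ_def]
    by_cases h0 : R θ = 0
    · simp [h0]
    · rw [h1, hRF θ h0, mul_zero, zero_sub, norm_neg]
      field_simp
      ring
  have hdiff : ∫ θ, R θ * ‖G θ‖ ^ 2 ∂ell - ∫ θ, Q θ * ‖G' θ‖ ^ 2 ∂ell ≤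
      t * (B / (2 * η) + 2 * η * A + t / (1 - t) * A) := by
    have h1t : 0 < 1 - t := by linarith
    calc ∫ θ, R θ * ‖G θ‖ ^ 2 ∂ell - ∫ θ, Q θ * ‖G' θ‖ ^ 2 ∂ell
        = ∫ θ, (R θ * ‖G θ‖ ^ 2 - Q θ * ‖G' θ‖ ^ 2) ∂ell := (integral_sub hRG hQG).symm
      _ ≤ ∫ θ, t * (1 / (2 * η) * ‖G θ - G' θ‖ ^ 2 + η * ‖G θ‖ ^ 2 +
            (η + t / (1 - t)) * ‖G' θ‖ ^ 2) ∂ell := by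
          refine integral_mono_ae (hRG.sub hQG) ((((hGG'.const_mul _).add
            (hGi.const_mul _)).add (hGi'.const_mul _)).const_mul _) ?_
          filter_upwards [hR, hR1, hQ] with θ h1 h2 h3
          have h4 : |‖G θ‖ - ‖G' θ‖| ≤ ‖G θ - G' θ‖ := abs_norm_sub_norm_le _ _
          set x := ‖G θ‖
          set y := ‖G' θ‖
          set d := ‖G θ - G' θ‖
          have hx : 0 ≤ x := norm_nonneg _
          have hy : 0 ≤ y := norm_nonneg _
          have h5 : |x ^ 2 - y ^ 2| ≤ 1 / (2 * η) * d ^ 2 + η * (x ^ 2 + y ^ 2) := by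
            have h6 : |x ^ 2 - y ^ 2| ≤ d * (x + y) := by
              rw [show x ^ 2 - y ^ 2 = (x - y) * (x + y) by ring, abs_mul,
                abs_of_nonneg (add_nonneg hx hy)]
              gcongr
            -- Young's inequality; the weight `η` is tuned later to the size of `‖F - F'‖`.
            have h7 : d * (x + y) ≤ 1 / (2 * η) * d ^ 2 + η * (x ^ 2 + y ^ 2) := by
              have h8 : 1 / (2 * η) * d ^ 2 + η * (x ^ 2 + y ^ 2) - d * (x + y) =
                  (d - η * (x + y)) ^ 2 / (2 * η) + η / 2 * (x - y) ^ 2 := by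
                field_simp
                ring
              have h9 : 0 ≤ (d - η * (x + y)) ^ 2 / (2 * η) + η / 2 * (x - y) ^ 2 := by positivity
              linarith
            exact h6.trans h7
          have h6 : R θ * (x ^ 2 - y ^ 2) ≤ t * (1 / (2 * η) * d ^ 2 + η * (x ^ 2 + y ^ 2)) := by
            refine (le_abs_self _).trans ?_
            rw [abs_mul]
            gcongr
          have h7 : R θ - Q θ = R θ * Q θ := by
            rw [hQ_def]
            field_simp
            ring
          have h8 : R θ * Q θ ≤ t * (t / (1 - t)) := by
            refine (le_abs_self _).trans ?_
            rw [abs_mul]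
            gcongr
          have h9 : (R θ - Q θ) * y ^ 2 ≤ t * (t / (1 - t)) * y ^ 2 := by
            rw [h7]
            gcongr
          have h10 : R θ * x ^ 2 - Q θ * y ^ 2 =
              R θ * (x ^ 2 - y ^ 2) + (R θ - Q θ) * y ^ 2 := by ring
          show R θ * x ^ 2 - Q θ * y ^ 2 ≤ _
          rw [h10]
          linarith
      _ = t * (1 / (2 * η) * ∫ θ, ‖G θ - G' θ‖ ^ 2 ∂ell + η * ∫ θ, ‖G θ‖ ^ 2 ∂ell +
            (η + t / (1 - t)) * ∫ θ, ‖G' θ‖ ^ 2 ∂ell) := by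
          have e1 := integral_add ((hGG'.const_mul (1 / (2 * η))).add (hGi.const_mul η))
            (hGi'.const_mul (η + t / (1 - t)))
          simp only [Pi.add_apply] at e1
          rw [integral_const_mul, e1, integral_add (hGG'.const_mul _) (hGi.const_mul _),
            integral_const_mul, integral_const_mul, integral_const_mul]
      _ ≤ t * (1 / (2 * η) * B + η * A + (η + t / (1 - t)) * A) := by
          have := (hG.integral_sub_sq_le hG' hF hF').trans hB
          have := (hG.integral_sq_le hF).trans hA
          have := (hG'.integral_sq_le hF').trans hA'
          gcongr
      _ = t * (B / (2 * η) + 2 * η * A + t / (1 - t) * A) := by ring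
  have hnn : 0 ≤ t * (B / (2 * η) + 2 * η * A + t / (1 - t) * A) := by
    have hA0 : 0 ≤ A := (integral_nonneg fun _ => sq_nonneg _).trans hA
    have hB0 : 0 ≤ B := (integral_nonneg fun _ => sq_nonneg _).trans hB
    have h1t : 0 < 1 - t := by linarith
    positivity
  -- The quantity is nonpositive by `hup`; `hlow` and `hdiff` bound it from below.
  rw [abs_le]
  constructor <;> linarith

/-! ### The uniform remainder and the expansion of the dual functional -/

/-- A bound for the squared `L²`-distance between two data. -/
def dataGap (F : T → ℂ) (t : ℝ) : ℝ :=
  3 * Real.sqrt t + 9 * tailSq F (Real.sqrt (Real.sqrt t))⁻¹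

/-- The modulus of differentiability of the dual functional. -/
def remainder (F : T → ℂ) (t : ℝ) : ℝ :=
  t * (Real.sqrt (dataGap F |t|) / 2 +
    2 * (Real.sqrt (dataGap F |t|) + |t|) * ∫ θ, ‖F θ‖ ^ 2 ∂ell +
    |t| / (1 - |t|) * ∫ θ, ‖F θ‖ ^ 2 ∂ell)

lemma tailSq_nonneg (F : T → ℂ) (N : ℝ) : 0 ≤ tailSq F N :=
  integral_nonneg fun _ => by
    dsimp only
    split_ifs <;> positivity

lemma dataGap_nonneg (F : T → ℂ) (t : ℝ) : 0 ≤ dataGap F t := by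
  have := tailSq_nonneg F (Real.sqrt (Real.sqrt t))⁻¹
  unfold dataGap
  positivity

/-- The truncation height `t^{-1/4}` tends to infinity, so the tail of `F` vanishes in the limit.
Limits are taken along `t ≠ 0` because at `0` the inverse is `0` and the tail is all of `‖F‖²`;
there the factor `t` suffices. -/
lemma remainder_isLittleO {F : T → ℂ} (hF : MemLp F 2 ell) :
    remainder F =o[𝓝 0] fun t : ℝ => t := by
  have habs : Tendsto (fun t : ℝ => |t|) (𝓝[≠] 0) (𝓝[>] 0) := by
    refine tendsto_nhdsWithin_iff.2 ⟨?_, ?_⟩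
    · simpa using (continuous_abs.tendsto (0 : ℝ)).mono_left nhdsWithin_le_nhds
    · filter_upwards [self_mem_nhdsWithin] with t ht using abs_pos.2 ht
  have hsqrt : Tendsto Real.sqrt (𝓝[>] 0) (𝓝[>] 0) := by
    refine tendsto_nhdsWithin_iff.2 ⟨?_, ?_⟩
    · simpa using (Real.continuous_sqrt.tendsto 0).mono_left nhdsWithin_le_nhds
    · filter_upwards [self_mem_nhdsWithin] with t ht using Real.sqrt_pos.2 ht
  have hgap : Tendsto (dataGap F) (𝓝[>] 0) (𝓝 0) := by
    have h1 := (tendsto_tailSq hF).comp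
      (tendsto_inv_nhdsGT_zero.comp (hsqrt.comp hsqrt))
    have h2 := ((hsqrt.mono_right nhdsWithin_le_nhds).const_mul 3).add (h1.const_mul 9)
    rw [mul_zero, mul_zero, add_zero] at h2
    exact h2
  have hs : Tendsto (fun t => Real.sqrt (dataGap F |t|)) (𝓝[≠] 0) (𝓝 0) := by
    simpa [Function.comp_def] using (Real.continuous_sqrt.tendsto 0).comp (hgap.comp habs)
  have ha : Tendsto (fun t : ℝ => |t|) (𝓝[≠] 0) (𝓝 0) := habs.mono_right nhdsWithin_le_nhds
  have hlim : Tendsto (fun t : ℝ => Real.sqrt (dataGap F |t|) / 2 +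
      2 * (Real.sqrt (dataGap F |t|) + |t|) * ∫ θ, ‖F θ‖ ^ 2 ∂ell +
      |t| / (1 - |t|) * ∫ θ, ‖F θ‖ ^ 2 ∂ell) (𝓝[≠] 0) (𝓝 0) := by
    have h1 := (ha.div (ha.const_sub 1) (by norm_num)).mul_const (∫ θ, ‖F θ‖ ^ 2 ∂ell)
    have h2 := ((hs.add ha).const_mul 2).mul_const (∫ θ, ‖F θ‖ ^ 2 ∂ell)
    simpa using ((hs.div_const 2).add h2).add h1
  rw [isLittleO_iff]
  intro c hc
  have h1 := hlim.eventually (Metric.ball_mem_nhds 0 hc)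
  rw [eventually_nhdsWithin_iff] at h1
  filter_upwards [h1] with t ht
  rw [remainder, norm_mul, mul_comm]
  rcases eq_or_ne t 0 with h0 | h0
  · rw [h0, norm_zero, mul_zero, mul_zero]
  · have := ht h0
    rw [dist_zero_right] at this
    gcongr

section

variable {I : Set T} {f : T → ℂ} {μ h : T → ℝ} {t : ℝ}

/-- First-order expansion of the dual functional. -/
theorem abs_dualFunctional_sub_le (hI : NullMeasurableSet I ell)
    (hf : MemLp f 2 (ell.restrict I)) (hμ : LogIntegrableOn μ Iᶜ)
    (hr : AEStronglyMeasurable (fun θ => h θ / μ θ) (ell.restrict Iᶜ)) (ht0 : 0 ≤ t) (ht1 : t < 1)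
    (hrt : ∀ᵐ θ ∂(ell.restrict Iᶜ), |h θ / μ θ| ≤ t) {M : T → ℝ}
    (hM : MemL1Weighted M Iᶜ μ) (hhM : MemL1Weighted M Iᶜ h) {G : T → ℂ}
    (hG : IsHardyProj (datum I f μ) G) :
    |dualFunctional I f M (fun θ => μ θ + h θ) - dualFunctional I f M μ -
      (∫ θ in Iᶜ, h θ / μ θ * ‖G θ‖ ^ 2 ∂ell - ∫ θ in Iᶜ, h θ * M θ ^ 2 ∂ell)| ≤
      remainder (datum I f μ) t := by
  have hν := hμ.add hr ht1 hrt
  have hF := memLp_datum hI hf hμ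
  have hF' := memLp_datum hI hf hν
  obtain ⟨D, E, hD, hE, hDR, hED, hD1, hFF'⟩ := exists_multiplier hI hμ hr ht0 ht1 hrt f
  obtain ⟨G', hG'⟩ := exists_isHardyProj hF'
  have hνM : MemL1Weighted M Iᶜ (fun θ => μ θ + h θ) := by
    have := hM.add hhM
    refine this.congr (.of_forall fun θ => ?_)
    simp only [Pi.add_apply]
    ring
  rw [dualFunctional_eq hI hf hν hνM hG', dualFunctional_eq hI hf hμ hM hG]
  have hsum : ∫ θ in Iᶜ, (μ θ + h θ) * M θ ^ 2 ∂ell =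
      ∫ θ in Iᶜ, μ θ * M θ ^ 2 ∂ell + ∫ θ in Iᶜ, h θ * M θ ^ 2 ∂ell := by
    simp_rw [add_mul]
    exact integral_add hM hhM
  set F := datum I f μ with hF_def
  set F' := datum I f (fun θ => μ θ + h θ) with hF'_def
  set R : T → ℝ := concat I (fun _ => 0) (fun θ => h θ / μ θ) with hR_def
  have hRm : AEStronglyMeasurable R ell := by
    rw [← Measure.restrict_univ (μ := ell), ← Set.union_compl_self I]
    exact aestronglyMeasurable_union_iff.2
      ⟨aestronglyMeasurable_const.congr (concat_ae_eq_left hI _ _).symm,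
        hr.congr (concat_ae_eq_right hI _ _).symm⟩
  have hR : ∀ᵐ θ ∂ell, |R θ| ≤ t := by
    refine ae_of_ae_restrict_of_ae_restrict_compl I ?_ ?_
    · filter_upwards [concat_ae_eq_left hI (fun _ => (0 : ℝ)) (fun θ => h θ / μ θ)] with θ hθ
      rw [hR_def, hθ, abs_zero]
      exact ht0
    · filter_upwards [concat_ae_eq_right hI (fun _ => (0 : ℝ)) (fun θ => h θ / μ θ), hrt]
        with θ hθ h1
      rwa [hR_def, hθ]
  have hRF : ∀ θ, R θ ≠ 0 → F θ = 0 := fun θ h0 => by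
    have hθ : θ ∉ I := fun hθ => h0 (concat_of_mem _ _ hθ)
    exact concat_of_notMem _ _ hθ
  have hRG : ∫ θ, R θ * ‖G θ‖ ^ 2 ∂ell = ∫ θ in Iᶜ, h θ / μ θ * ‖G θ‖ ^ 2 ∂ell := by
    rw [← setIntegral_eq_integral_of_forall_compl_eq_zero (s := Iᶜ)]
    · refine integral_congr_ae ?_
      filter_upwards [concat_ae_eq_right hI (fun _ => (0 : ℝ)) (fun θ => h θ / μ θ)] with θ hθ
      rw [hR_def, hθ]
    · intro θ hθ
      rw [hR_def, concat_of_mem _ _ (not_not.1 hθ), zero_mul]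
  -- `|D| = 1` wherever `F` does not vanish.
  have hnorm : ∫ θ, ‖F' θ‖ ^ 2 ∂ell = ∫ θ, ‖F θ‖ ^ 2 ∂ell := by
    refine integral_congr_ae ?_
    filter_upwards [hFF', hDR] with θ h1 h2
    rw [h1, norm_mul, mul_pow, h2]
    by_cases h0 : R θ = 0
    · rw [h0]; ring
    · rw [hRF θ h0]; simp
  have hgap : 0 < t → ∫ θ, ‖F θ - F' θ‖ ^ 2 ∂ell ≤ dataGap F t := by
    intro ht
    have hV : ∀ᵐ θ ∂ell, ‖D θ - 1‖ ≤ 3 := by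
      filter_upwards [hDR, hR] with θ h1 h2
      have h3 : ‖D θ‖ ≤ 2 := by nlinarith [(abs_le.1 h2).2, norm_nonneg (D θ)]
      have h4 := norm_sub_le (D θ) 1
      rw [norm_one] at h4
      linarith
    have h1 := integral_norm_mul_sq_le (hD.1.1.sub aestronglyMeasurable_const) hV hF
      (Real.sqrt (Real.sqrt t))⁻¹
    have h2 : ∫ θ, ‖F θ - F' θ‖ ^ 2 ∂ell = ∫ θ, ‖(D θ - 1) * F θ‖ ^ 2 ∂ell := by
      refine integral_congr_ae ?_
      filter_upwards [hFF'] with θ h1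
      rw [h1, norm_sub_rev, sub_one_mul]
    rw [h2, dataGap]
    have h3 : ((Real.sqrt (Real.sqrt t))⁻¹) ^ 2 = (Real.sqrt t)⁻¹ := by
      rw [inv_pow, Real.sq_sqrt (Real.sqrt_nonneg t)]
    have h4 : (Real.sqrt t)⁻¹ * (3 * t) = 3 * Real.sqrt t := by
      have h5 := Real.sqrt_pos.2 ht
      rw [inv_mul_eq_div, div_eq_iff h5.ne', mul_assoc, Real.mul_self_sqrt ht0]
    have h5 : (Real.sqrt t)⁻¹ * ∫ θ, ‖D θ - 1‖ ^ 2 ∂ell ≤ (Real.sqrt t)⁻¹ * (3 * t) := by gcongr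
    simp only [Pi.sub_apply] at h1
    rw [h3] at h1
    linarith
  have key := fun B η hB hη => abs_distSq_sub_le (B := B) (η := η) hF hF' hG hG' hD hE ht0 ht1 hRm
    hR hDR hED hFF' hRF le_rfl hnorm.le hB hη
  rw [hRG] at key
  rw [hsum]
  have hgoal : ∀ a b c d e k : ℝ, a - (d + e) - (b - d) - (k - e) = a - b - k := by
    intros; ring
  rw [hgoal _ _ 0]
  rcases ht0.eq_or_lt with h0 | hpos
  · have := key _ 1 le_rfl one_pos
    rw [← h0, zero_mul] at this
    rw [remainder, ← h0, zero_mul]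
    exact this
  · set s := Real.sqrt (dataGap F t) with hs_def
    have hs : 0 ≤ s := Real.sqrt_nonneg _
    have hss : dataGap F t = s ^ 2 := (Real.sq_sqrt (dataGap_nonneg F t)).symm
    -- With `η` of the order of `s`, both `s² / (2η)` and `η` are small; adding `t` makes `η`
    -- visibly positive.
    have h1 := key _ (s + t) (hgap hpos) (by linarith)
    refine h1.trans ?_
    rw [remainder, abs_of_pos hpos, ← hs_def]
    have h2 : dataGap F t / (2 * (s + t)) ≤ s / 2 := by
      rw [hss, div_le_div_iff₀ (by linarith) two_pos]
      nlinarith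
    gcongr

end

end BoundedExtremal

end

open BoundedExtremal in
theorem mainTheorem11
    (I : Set BoundedExtremal.T)
    (hI : 0 < BoundedExtremal.ell I) (hJ : 0 < BoundedExtremal.ell Iᶜ)
    (hfrontier : BoundedExtremal.ell (frontier I) = 0)
    (f : BoundedExtremal.T → ℂ)
    (hf : MemLp f 2 (BoundedExtremal.ell.restrict I))
    (hfLL : BoundedExtremal.MemLLogL
      (BoundedExtremal.concat I (fun θ => ‖f θ‖ ^ 2) (fun _ => 0)))
    (μ : BoundedExtremal.T → ℝ) :
    ∃ o : ℝ → ℝ, o =o[𝓝 0] (fun t : ℝ => t) ∧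
      ∀ M : BoundedExtremal.T → ℝ,
        MemLp M 2 (BoundedExtremal.ell.restrict Iᶜ) →
        (∀ᵐ θ ∂(BoundedExtremal.ell.restrict Iᶜ), 0 ≤ M θ) →
        BoundedExtremal.LogIntegrableOn M Iᶜ →
        ¬ BoundedExtremal.IsAdmissibleTrace I f M →
        BoundedExtremal.MemL1Plus M Iᶜ μ →
        ∀ h : BoundedExtremal.T → ℝ,
          AEStronglyMeasurable h (BoundedExtremal.ell.restrict Iᶜ) →
          eLpNorm (fun θ => h θ / μ θ) ∞ (BoundedExtremal.ell.restrict Iᶜ) < 1 →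
          BoundedExtremal.MemL1Plus M Iᶜ (fun θ => μ θ + h θ) ∧
          BoundedExtremal.MemL1Weighted M Iᶜ h ∧
          (∀ᵐ θ ∂(BoundedExtremal.ell.restrict Iᶜ),
            ∃ b, BoundedExtremal.HasNontangentialLimit
              (BoundedExtremal.carleman I f μ) θ b) ∧
          IntegrableOn
            (fun θ => h θ *
              ‖BoundedExtremal.boundaryValue (BoundedExtremal.carleman I f μ) θ‖ ^ 2)
            Iᶜ BoundedExtremal.ell ∧
          |BoundedExtremal.dualFunctional I f M (fun θ => μ θ + h θ)
              - BoundedExtremal.dualFunctional I f M μ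
              - ∫ θ in Iᶜ, h θ *
                  (‖BoundedExtremal.boundaryValue (BoundedExtremal.carleman I f μ) θ‖ ^ 2
                    - M θ ^ 2) ∂BoundedExtremal.ell|
            ≤ o (BoundedExtremal.normLinf Iᶜ (fun θ => h θ / μ θ)) := by
  -- The function `o` must be fixed before `M`; if `log μ` is not integrable, no `M` is admissible.
  by_cases hμ : LogIntegrableOn μ Iᶜ
  swap
  · exact ⟨fun _ => 0, isLittleO_zero _ _, fun M _ _ _ _ h => absurd h.2.2 hμ⟩
  have hIn := nullMeasurableSet_of_frontier hfrontier
  have hF := memLp_datum hIn hf hμ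
  refine ⟨remainder (datum I f μ), remainder_isLittleO hF, fun M _ _ _ _ hμM h hhm hlt => ?_⟩
  set t := normLinf Iᶜ (fun θ => h θ / μ θ) with ht_def
  have ht0 : 0 ≤ t := ENNReal.toReal_nonneg
  have ht1 : t < 1 := by
    have := (ENNReal.toReal_lt_toReal hlt.ne_top ENNReal.one_ne_top).2 hlt
    rwa [ENNReal.toReal_one] at this
  have hrt : ∀ᵐ θ ∂(ell.restrict Iᶜ), |h θ / μ θ| ≤ t := by
    have h1 := ae_le_eLpNormEssSup (f := fun θ => h θ / μ θ) (μ := ell.restrict Iᶜ)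
    filter_upwards [h1] with θ h2
    rw [← eLpNorm_exponent_top] at h2
    have h3 := ENNReal.toReal_mono hlt.ne_top h2
    rwa [toReal_enorm] at h3
  -- Measurability of `μ` is recovered from that of its logarithm.
  have hμm : AEMeasurable μ (ell.restrict Iᶜ) := by
    refine (Real.measurable_exp.comp_aemeasurable hμ.2.aemeasurable).congr ?_
    filter_upwards [hμ.1] with θ h0 using Real.exp_log h0
  have hr : AEStronglyMeasurable (fun θ => h θ / μ θ) (ell.restrict Iᶜ) :=
    (hhm.aemeasurable.div hμm).aestronglyMeasurable
  have hhM : MemL1Weighted M Iᶜ h := by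
    refine (Integrable.bdd_mul hμM.2.1 hr hrt).congr ?_
    filter_upwards [hμ.1] with θ h0
    field_simp
  have hν := hμ.add hr ht1 hrt
  obtain ⟨G, hG⟩ := exists_isHardyProj hF
  have hlim := ae_hasNontangentialLimit_carleman hIn hf hμ hG
  -- On `J` the boundary function of `g_μ` is `G / w` with `|w|² = μ`; this gives integrability too,
  -- since `h/μ` is bounded.
  have hbdry : ∀ᵐ θ ∂(ell.restrict Iᶜ), h θ * ‖boundaryValue (carleman I f μ) θ‖ ^ 2 =
      h θ / μ θ * ‖G θ‖ ^ 2 := by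
    filter_upwards [ae_restrict_of_ae hlim, norm_outerBdry_logModulus_right hIn hμ] with θ h1 h2
    rw [h1.boundaryValue_eq, norm_div, div_pow, h2]
    ring
  have hrG : IntegrableOn (fun θ => h θ / μ θ * ‖G θ‖ ^ 2) Iᶜ ell :=
    (integrable_norm_sq (hG.1.1.restrict Iᶜ)).bdd_mul hr hrt
  have hhG : IntegrableOn (fun θ => h θ * ‖boundaryValue (carleman I f μ) θ‖ ^ 2) Iᶜ ell :=
    hrG.congr (hbdry.mono fun _ => Eq.symm)
  refine ⟨⟨hν.1.mono fun _ => le_of_lt, ?_, hν⟩, hhM,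
    ae_restrict_of_ae (hlim.mono fun θ h1 => ⟨_, h1⟩), hhG, ?_⟩
  · refine (hμM.2.1.add hhM).congr (.of_forall fun θ => ?_)
    simp only [Pi.add_apply]
    ring
  · have h1 : ∫ θ in Iᶜ, h θ * (‖boundaryValue (carleman I f μ) θ‖ ^ 2 - M θ ^ 2) ∂ell =
        ∫ θ in Iᶜ, h θ / μ θ * ‖G θ‖ ^ 2 ∂ell - ∫ θ in Iᶜ, h θ * M θ ^ 2 ∂ell := by
      simp_rw [mul_sub]
      rw [integral_sub hhG hhM, integral_congr_ae hbdry]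
    rw [h1]
    exact abs_dualFunctional_sub_le hIn hf hμ hr ht0 ht1 hrt hμM.2.1 hhM hG
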